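/- Let $K$ be an algebraically closed field of characteristic zero and $n\ge 0$. Let $\bar U(n)$ be the localization of $K[\tilde h_1,\dots,\tilde h_n]$ at the multiplicative set generated by all $\tilde h_{ij}+k$ with $i\ne j$, $k\in\mathbb Z$, where $\tilde h_{ij}=\tilde h_i-\tilde h_j$. For $f\in\bar U(n)$ let $f[-\varepsilon_j]$ be the image of $f$ under $\tilde h_i\mapsto\tilde h_i-\delta_{ij}$, and put $\Delta_jf=f-f[-\varepsilon_j]$ and $\chi_j=\prod_{k\ne j}\tilde h_{jk}$. Let $\mathcal W=\sum_j\mathcal W_j\subset\bar U(n)$, where $\mathcal W_j=\{\pi(\tilde h_j)/\chi_j:\pi\in K[t]\}$. For $\sigma\in\mathcal W$ put $\sigma_i=\Delta_i\sigma$. Let $\mathrm{Diff}_{h,\sigma}(n)$ be the $K$-algebra generated by $\bar U(n)$ and elements $x^i,\bar\partial_i$ ($1\le i\le n$), subject to the relations of $\bar U(n)$ and the defining relations $$\tilde h_ix^j=x^j(\tilde h_i+\delta_{ij}),\qquad \tilde h_i\bar\partial_j=\bar\partial_j(\tilde h_i-\delta_{ij})\qquad\text{for all } i,j,$$ $$x^ix^j=\frac{\tilde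 h_{ij}+1}{\tilde h_{ij}}\,x^jx^i,\qquad \bar\partial_i\bar\partial_j=\frac{\tilde h_{ij}-1}{\tilde h_{ij}}\,\bar\partial_j\bar\partial_i\qquad (i<j),$$ $$x^i\bar\partial_j=\bar\partial_jx^i\quad(i<j),\qquad x^i\bar\partial_j=\frac{\tilde h_{ij}(\tilde h_{ij}-2)}{(\tilde h_{ij}-1)^2}\,\bar\partial_jx^i\quad(i>j),$$ $$x^i\bar\partial_i=\sum_j\frac1{1-\tilde h_{ij}}\,\bar\partial_jx^j-\sigma_i .$$ Let $e(t)=\prod_i(1+\tilde h_it)$ and $\Gamma_i=\bar\partial_ix^i$. Call a polynomial $\rho(t)\in\bar U(n)[t]$ of degree at most $n-1$ *admissible* if $$\Delta_j\rho(t)=\frac{e(t)}{1+\tilde h_jt}\,\sigma_j\qquad (j=1,\dots,n).$$ Then admissible polynomials exist: whenever $\sigma=\sum_k\pi_k(\tilde h_k)/\chi_k$ with $\pi_k\in K[t]$, and $p\in K[t]$ has degree at most $n-1$, the polynomial $$\rho(t)=\sum_{k}\frac{e(t)}{1+\tilde h_kt}\,\frac{\pi_k(\tilde h_k)}{\chi_k}+p(t)$$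 is admissible. Moreover, let $\rho(t)$ be any admissible polynomial, and define $c_1,\dots,c_n\in\mathrm{Diff}_{h,\sigma}(n)$ by $$\sum_{i=1}^n\frac{e(t)}{1+\tilde h_it}\,\Gamma_i-\rho(t)=\sum_{k=1}^nc_kt^{k-1}.$$ Then the center of $\mathrm{Diff}_{h,\sigma}(n)$ is the polynomial ring $K[c_1,\dots,c_n]$; that is, $t_k\mapsto c_k$ defines an isomorphism of $K$-algebras from $K[t_1,\dots,t_n]$ onto the center. -/

import Mathlib

open Polynomial

namespace HDiff

section Coefficients

variable (K : Type*) [Field K] (n : ℕ)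

/-- The multiplicative set in `U(n) = K[h̃₁, …, h̃ₙ]` generated by the elements
`h̃ᵢ - h̃ⱼ + k` with `i ≠ j` and `k` an integer. -/
noncomputable def denominators : Submonoid (MvPolynomial (Fin n) K) :=
  Submonoid.closure {p | ∃ (i j : Fin n) (k : ℤ), i ≠ j ∧
    p = MvPolynomial.X i - MvPolynomial.X j + (k : MvPolynomial (Fin n) K)}

/-- The ring `Ū(n)`: the localization of `U(n)` at the elements `h̃ᵢ - h̃ⱼ + k`. -/
abbrev Ubar : Type _ := Localization (denominators K n)

variable {n}

/-- The element `h̃ᵢ` of `Ū(n)`. -/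
noncomputable def h (i : Fin n) : Ubar K n :=
  algebraMap (MvPolynomial (Fin n) K) (Ubar K n) (MvPolynomial.X i)

/-- The element `h̃ᵢⱼ = h̃ᵢ - h̃ⱼ`. -/
noncomputable def hh (i j : Fin n) : Ubar K n := h K i - h K j

theorem isUnit_hh_add {i j : Fin n} (hij : i ≠ j) (k : ℤ) :
    IsUnit (hh K i j + (k : Ubar K n)) := by
  have hm : (MvPolynomial.X i - MvPolynomial.X j + (k : MvPolynomial (Fin n) K)) ∈
      denominators K n := Submonoid.subset_closure ⟨i, j, k, hij, rfl⟩
  have := IsLocalization.map_units (Ubar K n) (⟨_, hm⟩ : denominators K n)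
  simpa [hh, h] using this

/-- The translation `h̃ᵢ ↦ h̃ᵢ - δᵢⱼ`, as a homomorphism from `U(n)` to `Ū(n)`. -/
noncomputable def preShift (j : Fin n) : MvPolynomial (Fin n) K →ₐ[K] Ubar K n :=
  MvPolynomial.aeval fun i => h K i - if i = j then 1 else 0

theorem isUnit_preShift (j : Fin n) (y : denominators K n) : IsUnit (preShift K j y) := by
  obtain ⟨y, hy⟩ := y
  induction hy using Submonoid.closure_induction with
  | one => simp
  | mul a b _ _ ha hb => simpa using ha.mul hb
  | mem p hp =>
    obtain ⟨a, b, k, hab, rfl⟩ := hp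
    have := isUnit_hh_add K hab
      (k - (if a = j then 1 else 0) + (if b = j then 1 else 0))
    convert this using 1
    simp only [preShift, map_add, map_sub, MvPolynomial.aeval_X, map_intCast, hh]
    push_cast
    ring

/-- The automorphism `f ↦ f[-εⱼ]` of `Ū(n)`, induced by `h̃ᵢ ↦ h̃ᵢ - δᵢⱼ`. -/
noncomputable def shift (j : Fin n) : Ubar K n →ₐ[K] Ubar K n :=
  IsLocalization.liftAlgHom (M := denominators K n) (f := preShift K j) (isUnit_preShift K j)

theorem shift_h (i j : Fin n) : shift K j (h K i) = h K i - if i = j then 1 else 0 := by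
  simp [shift, preShift, h, IsLocalization.liftAlgHom_apply]

variable {K}

/-- The finite difference operator `Δⱼ f = f - f[-εⱼ]`. -/
noncomputable def delta (j : Fin n) (f : Ubar K n) : Ubar K n := f - shift K j f

variable (K)

/-- `χᵢ = ∏_{k ≠ i} h̃ᵢₖ`. -/
noncomputable def chi (i : Fin n) : Ubar K n := ∏ k ∈ Finset.univ.erase i, hh K i k

theorem isUnit_chi (i : Fin n) : IsUnit (chi K i) := by
  unfold chi
  refine Finset.prod_induction _ IsUnit (fun _ _ => IsUnit.mul) isUnit_one fun k hk => ?_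
  simpa using isUnit_hh_add K (Finset.ne_of_mem_erase hk).symm 0

/-- The linear map `π ↦ π(h̃ⱼ) / χⱼ`; here `χⱼ` is invertible in `Ū(n)`. -/
noncomputable def toW (j : Fin n) : K[X] →ₗ[K] Ubar K n :=
  LinearMap.mulRight K (Ring.inverse (chi K j)) ∘ₗ (aeval (h K j)).toLinearMap

theorem toW_mul_chi (j : Fin n) (q : K[X]) : toW K j q * chi K j = aeval (h K j) q := by
  simp [toW, mul_assoc, Ring.inverse_mul_cancel _ (isUnit_chi K j)]

variable (n) in
/-- The space of potentials `W = ∑ⱼ Wⱼ`, where `Wⱼ` consists of the elements `π(h̃ⱼ) / χⱼ`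
with `π` a polynomial in one variable over `K`. -/
noncomputable def W : Submodule K (Ubar K n) := ⨆ j : Fin n, LinearMap.range (toW K j)

/-- The polynomial `e(t) / (1 + h̃ᵢ t)`, that is `∏_{k ≠ i} (1 + h̃ₖ t)`. -/
noncomputable def eDiv (i : Fin n) : (Ubar K n)[X] :=
  ∏ k ∈ Finset.univ.erase i, (1 + C (h K k) * X)

theorem mul_eDiv (i : Fin n) :
    (1 + C (h K i) * X) * eDiv K i = ∏ k : Fin n, (1 + C (h K k) * X) :=
  Finset.mul_prod_erase _ (fun k => 1 + C (h K k) * X) (Finset.mem_univ i)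

variable {K}

/-- `ρ(t)` is a polynomial of degree at most `n - 1` over `Ū(n)` which satisfies
`Δⱼ ρ(t) = (e(t) / (1 + h̃ⱼ t)) Δⱼ σ` for all `j`. -/
structure IsRho (σ : Ubar K n) (ρ : (Ubar K n)[X]) : Prop where
  degree_lt : ρ.degree < n
  difference : ∀ j : Fin n, ρ - ρ.map (shift K j : Ubar K n →+* Ubar K n) =
    eDiv K j * C (delta j σ)

/-- The polynomial `∑ₖ (e(t) / (1 + h̃ₖ t)) (πₖ(h̃ₖ) / χₖ) + p(t)`. -/
noncomputable def explicitRho (q : Fin n → K[X]) (p : K[X]) : (Ubar K n)[X] :=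
  ∑ k, eDiv K k * C (toW K k (q k)) + p.map (algebraMap K (Ubar K n))

end Coefficients

section Ring

variable {K : Type*} [Field K] {n : ℕ}

variable (K n) in
/-- Generators of the ring of generalized `h`-deformed differential operators: the elements of
the coefficient ring `Ū(n)`, the `xⁱ` and the `∂̄ᵢ`. -/
inductive Gen : Type _
  | coeff (f : Ubar K n)
  | x (i : Fin n)
  | d (i : Fin n)

variable (K n) in
/-- The free `K`-algebra on the generators. -/
abbrev Free : Type _ := FreeAlgebra K (Gen K n)

/-- An element of `Ū(n)` as an element of the free algebra. -/
def fc (f : Ubar K n) : Free K n := FreeAlgebra.ι K (Gen.coeff f)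

variable (K) in
/-- The generator `xⁱ` in the free algebra. -/
def fx (i : Fin n) : Free K n := FreeAlgebra.ι K (Gen.x i)

variable (K) in
/-- The generator `∂̄ᵢ` in the free algebra. -/
def fd (i : Fin n) : Free K n := FreeAlgebra.ι K (Gen.d i)

/-- The defining relations of `Diff_h(σ₁, …, σₙ)`. The first three say that `Ū(n)` maps to the
quotient by a homomorphism of `K`-algebras. All elements passed to `Ring.inverse` are
units, the case `i = j` of `1 - h̃ᵢⱼ` included. -/
inductive Rel (s : Fin n → Ubar K n) : Free K n → Free K n → Prop
  | coeff_algebraMap (a : K) :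
      Rel s (fc (algebraMap K (Ubar K n) a)) (algebraMap K (Free K n) a)
  | coeff_add (f g : Ubar K n) : Rel s (fc (f + g)) (fc f + fc g)
  | coeff_mul (f g : Ubar K n) : Rel s (fc (f * g)) (fc f * fc g)
  | weight_x (i j : Fin n) :
      Rel s (fc (h K i) * fx K j) (fx K j * fc (h K i + if i = j then 1 else 0))
  | weight_d (i j : Fin n) :
      Rel s (fc (h K i) * fd K j) (fd K j * fc (h K i - if i = j then 1 else 0))
  | x_x (i j : Fin n) (hij : i < j) :
      Rel s (fx K i * fx K j)
        (fc ((hh K i j + 1) * Ring.inverse (hh K i j)) * (fx K j * fx K i))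
  | d_d (i j : Fin n) (hij : i < j) :
      Rel s (fd K i * fd K j)
        (fc ((hh K i j - 1) * Ring.inverse (hh K i j)) * (fd K j * fd K i))
  | x_d_lt (i j : Fin n) (hij : i < j) : Rel s (fx K i * fd K j) (fd K j * fx K i)
  | x_d_gt (i j : Fin n) (hij : j < i) :
      Rel s (fx K i * fd K j)
        (fc (hh K i j * (hh K i j - 2) * Ring.inverse ((hh K i j - 1) ^ 2)) *
          (fd K j * fx K i))
  | x_d_same (i : Fin n) :
      Rel s (fx K i * fd K i)
        (∑ j, fc (Ring.inverse (1 - hh K i j)) * (fd K j * fx K j) - fc (s i))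

/-- The ring `Diff_h(σ₁, …, σₙ)`, a `K`-algebra. -/
abbrev Diff (s : Fin n → Ubar K n) : Type _ := RingQuot (Rel s)

/-- The ring `Diff_{h,σ}(n) = Diff_h(Δ₁σ, …, Δₙσ)` with potential `σ`. -/
abbrev DiffPot (σ : Ubar K n) : Type _ := Diff fun j => delta j σ

variable (s : Fin n → Ubar K n)

/-- The structure homomorphism from `Ū(n)` to `Diff_h(σ₁, …, σₙ)`. -/
def coeffHom : Ubar K n →ₐ[K] Diff s where
  toFun f := RingQuot.mkAlgHom K (Rel s) (fc f)
  map_one' := by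
    have := RingQuot.mkAlgHom_rel K (Rel.coeff_algebraMap (s := s) (1 : K))
    simpa using this
  map_mul' f g := by
    simpa using RingQuot.mkAlgHom_rel K (Rel.coeff_mul (s := s) f g)
  map_zero' := by
    have := RingQuot.mkAlgHom_rel K (Rel.coeff_algebraMap (s := s) (0 : K))
    simpa using this
  map_add' f g := by
    simpa using RingQuot.mkAlgHom_rel K (Rel.coeff_add (s := s) f g)
  commutes' a := by
    simpa using RingQuot.mkAlgHom_rel K (Rel.coeff_algebraMap (s := s) a)

/-- The element `Γᵢ = ∂̄ᵢ xⁱ`. -/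
def Gam (i : Fin n) : Diff s :=
  RingQuot.mkAlgHom K (Rel s) (fd K i) * RingQuot.mkAlgHom K (Rel s) (fx K i)

/-- The polynomial `c(t) = ∑ᵢ (e(t) / (1 + h̃ᵢ t)) Γᵢ - ρ(t)` over `Diff_h(σ₁, …, σₙ)`; the
variable `t` commutes with everything. -/
noncomputable def cPoly (ρ : (Ubar K n)[X]) : (Diff s)[X] :=
  ∑ i, (eDiv K i).map (coeffHom s : Ubar K n →+* Diff s) * C (Gam s i) -
    ρ.map (coeffHom s : Ubar K n →+* Diff s)

end Ring

end HDiff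

/-! The `c_k` are central by an identity between linear factors. For `i ≠ j`, moving `xʲ` past `Γᵢ`
produces the factor `h̃ⱼᵢ / (h̃ⱼᵢ - 1)`, while `xʲ Γⱼ = (xʲ ∂̄ⱼ) xʲ` is given by the last defining
relation. The translate of `e(t) / (1 + h̃ᵢ t)` in `h̃ⱼ`, multiplied by that factor, differs from
`e(t) / (1 + h̃ᵢ t)` by a multiple of `e(t) / (1 + h̃ⱼ t)` (`map_shift_eDiv_mul_gamFactor`). These
differences cancel the sum in the last relation; what remains is the `σⱼ` term, which the difference
equation for `ρ` absorbs. The relations with `∂̄ⱼ` are the same ones read backwards.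

Nothing else is central. By Lagrange interpolation the polynomials `e(t) / (1 + h̃ᵢ t)` form a basis
over `Ū(n)` of the polynomials of degree below `n`, so each `Γᵢ` is an affine combination of the
`c_k`. Any product of generators of total weight zero can be reordered into factors `Γᵢ` and `xⁱ
∂̄ᵢ`, hence the centralizer of the `h̃ᵢ` consists of polynomials `P(c)` over `Ū(n)`. Commuting with
every `xʲ` makes the coefficients of `P` invariant under all translations, and in characteristic
zero such coefficients are constants (`exists_algebraMap_of_shift_eq`).

Algebraic independence, even over `Ū(n)`, comes from a representation on `Ū(n)[t₁, …, tₙ]` rather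
than from an ordered basis of the algebra. There `xⁱ` is a translation times a unit, `Γᵢ` is
multiplication by the polynomial found by solving `c_k = t_k` for `Γᵢ`, and `∂̄ᵢ` is `Γᵢ` after the
inverse of `xⁱ`. Then `P(c)` sends `1` to `P`, and the invertibility of `xʲ` in this representation
allows it to be cancelled. -/

namespace HDiff

/-! ### Homomorphisms out of `Ū(n)` and translation invariants -/

section Localization

variable {K : Type*} [Field K] {n : ℕ}

/-- Intertwining two homomorphisms out of `Ū(n)` may be checked on the generators `h̃ᵢ`. -/
theorem intertwine_of_h {A : Type*} [Ring A] [Algebra K A] (φ ψ : Ubar K n →ₐ[K] A) (y : A)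
    (hy : ∀ i, y * φ (h K i) = ψ (h K i) * y) (f : Ubar K n) : y * φ f = ψ f * y := by
  have poly : ∀ p : MvPolynomial (Fin n) K,
      y * φ (algebraMap _ _ p) = ψ (algebraMap _ _ p) * y := by
    intro p
    induction p using MvPolynomial.induction_on with
    | C a =>
      have e : algebraMap (MvPolynomial (Fin n) K) (Ubar K n) (MvPolynomial.C a) =
          algebraMap K (Ubar K n) a :=
        (IsScalarTower.algebraMap_apply K (MvPolynomial (Fin n) K) (Ubar K n) a).symm
      rw [e, AlgHom.commutes, AlgHom.commutes]
      exact (Algebra.commutes a y).symm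
    | add p q hp hq => simp only [map_add, mul_add, add_mul, hp, hq]
    | mul_X p i hp =>
      rw [map_mul, map_mul, map_mul, ← mul_assoc, hp, mul_assoc, mul_assoc]
      exact congrArg _ (hy i)
  obtain ⟨p, d, rfl⟩ := IsLocalization.exists_mk'_eq (denominators K n) f
  have hd := IsLocalization.map_units (Ubar K n) d
  have e := IsLocalization.mk'_spec (Ubar K n) p d
  set g := IsLocalization.mk' (Ubar K n) p d
  have hφ := hd.map φ
  refine hφ.mul_right_cancel ?_
  rw [mul_assoc, ← map_mul, e, poly, mul_assoc, poly, ← mul_assoc, ← map_mul, e]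

theorem algHom_ext_h {A : Type*} [Ring A] [Algebra K A] {φ ψ : Ubar K n →ₐ[K] A}
    (hy : ∀ i, φ (h K i) = ψ (h K i)) : φ = ψ := by
  refine AlgHom.ext fun f => ?_
  simpa using intertwine_of_h φ ψ 1 (by simpa using hy) f

theorem isUnit_aeval_denominators {S : Type*} [CommRing S] [Algebra K S] (a : Fin n → S)
    (ha : ∀ i j (k : ℤ), i ≠ j → IsUnit (a i - a j + (k : S))) (y : denominators K n) :
    IsUnit (MvPolynomial.aeval a (y : MvPolynomial (Fin n) K)) := by
  obtain ⟨y, hy⟩ := y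
  induction hy using Submonoid.closure_induction with
  | one => simp
  | mul a b _ _ ha hb => simpa using ha.mul hb
  | mem p hp =>
    obtain ⟨i, j, k, hij, rfl⟩ := hp
    simpa using ha i j k hij

/-- Evaluation of elements of `Ū(n)` at a tuple whose differences avoid the integers. -/
noncomputable def evalAt {S : Type*} [CommRing S] [Algebra K S] (a : Fin n → S)
    (ha : ∀ i j (k : ℤ), i ≠ j → IsUnit (a i - a j + (k : S))) : Ubar K n →ₐ[K] S :=
  IsLocalization.liftAlgHom (M := denominators K n) (f := MvPolynomial.aeval a)
    (isUnit_aeval_denominators a ha)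

theorem evalAt_algebraMap {S : Type*} [CommRing S] [Algebra K S] (a : Fin n → S)
    (ha : ∀ i j (k : ℤ), i ≠ j → IsUnit (a i - a j + (k : S))) (p : MvPolynomial (Fin n) K) :
    evalAt a ha (algebraMap (MvPolynomial (Fin n) K) (Ubar K n) p) = MvPolynomial.aeval a p := by
  simp [evalAt, IsLocalization.liftAlgHom_apply]

theorem evalAt_h {S : Type*} [CommRing S] [Algebra K S] (a : Fin n → S)
    (ha : ∀ i j (k : ℤ), i ≠ j → IsUnit (a i - a j + (k : S))) (i : Fin n) :
    evalAt a ha (h K i) = a i := by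
  simp [h, evalAt_algebraMap]

variable (K) in
/-- The inverse translation `h̃ᵢ ↦ h̃ᵢ + δᵢⱼ` of `Ū(n)`. -/
noncomputable def unshift (j : Fin n) : Ubar K n →ₐ[K] Ubar K n :=
  evalAt (fun i => h K i + if i = j then 1 else 0) (by
    intro a b k hab
    have e : (h K a + if a = j then 1 else 0) - (h K b + if b = j then 1 else 0) +
        (k : Ubar K n) = hh K a b + ((k + (if a = j then 1 else 0) - (if b = j then 1 else 0) : ℤ) :
          Ubar K n) := by
      simp only [hh]
      push_cast
      ring
    rw [e]
    exact isUnit_hh_add K hab _)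

theorem unshift_h (i j : Fin n) : unshift K j (h K i) = h K i + if i = j then 1 else 0 :=
  evalAt_h _ _ _

theorem apply_ite_one {A B : Type*} [Ring A] [Ring B] [Algebra K A] [Algebra K B]
    (φ : A →ₐ[K] B) (p : Prop) [Decidable p] :
    φ (if p then 1 else 0) = if p then 1 else 0 := by
  split_ifs <;> simp

variable (K) in
/-- The translation `f ↦ f[-εⱼ]` as an automorphism of `Ū(n)`. -/
noncomputable def shiftEquiv (j : Fin n) : Ubar K n ≃ₐ[K] Ubar K n :=
  AlgEquiv.ofAlgHom (shift K j) (unshift K j)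
    (algHom_ext_h fun i => by simp [shift_h, unshift_h])
    (algHom_ext_h fun i => by simp [shift_h, unshift_h])

@[simp] theorem shiftEquiv_apply (j : Fin n) (f : Ubar K n) : shiftEquiv K j f = shift K j f := rfl

theorem shift_surjective (j : Fin n) : Function.Surjective (shift K j) :=
  (shiftEquiv K j).surjective

/-- Clearing denominators would make `i - j` a multiple of `n + 1`, but `0 < |i - j| < n + 1`. -/
theorem int_sub_div_ne_zero [CharZero K] {i j : Fin n} (hij : i ≠ j) (k : ℤ) :
    ((i : ℕ) : K) / (n + 1 : ℕ) - ((j : ℕ) : K) / (n + 1 : ℕ) + (k : K) ≠ 0 := by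
  intro e
  have hn : ((n + 1 : ℕ) : K) ≠ 0 := by exact_mod_cast n.succ_ne_zero
  field_simp at e
  have e' : (i : ℤ) - (j : ℤ) + (n + 1) * k = 0 := by
    have : (((i : ℤ) - (j : ℤ) + (n + 1) * k : ℤ) : K) = 0 := by
      push_cast; push_cast at e; linear_combination e
    exact_mod_cast this
  have hi := i.2
  have hj := j.2
  have hne : (i : ℕ) ≠ j := fun h => hij (Fin.ext h)
  rcases lt_trichotomy k 0 with hk | rfl | hk
  · nlinarith
  · omega
  · nlinarith

variable [CharZero K]

/-- A tuple of rational numbers whose differences avoid the integers, translated by integers. -/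
theorem isUnit_genericPoint (m : Fin n → ℕ) (i j : Fin n) (k : ℤ) (hij : i ≠ j) :
    IsUnit ((((i : ℕ) : K) / (n + 1 : ℕ) - m i) - (((j : ℕ) : K) / (n + 1 : ℕ) - m j) + (k : K)) := by
  rw [isUnit_iff_ne_zero]
  convert int_sub_div_ne_zero (K := K) hij (k - m i + m j) using 1
  push_cast
  ring

/-- Evaluation of `Ū(n)` at the lattice points `i / (n + 1) - mᵢ`. -/
noncomputable def evalLattice (m : Fin n → ℕ) : Ubar K n →ₐ[K] K :=
  evalAt (fun i => ((i : ℕ) : K) / (n + 1 : ℕ) - m i) (isUnit_genericPoint m)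

theorem evalLattice_shift (m : Fin n → ℕ) (j : Fin n) (f : Ubar K n) :
    evalLattice m (shift K j f) = evalLattice (m + Pi.single j 1) f := by
  have : (evalLattice m).comp (shift K j) = evalLattice (m + Pi.single j 1) := by
    refine algHom_ext_h fun i => ?_
    simp only [AlgHom.comp_apply, shift_h, evalLattice, map_sub, evalAt_h, apply_ite_one,
      Pi.add_apply, Pi.single_apply]
    push_cast
    ring
  exact DFunLike.congr_fun this f

/-- Each unit step of the lattice point is one translation, so induction on `∑ mᵢ` walks back to the
base point without changing the value. -/
theorem evalLattice_of_shift_eq {f : Ubar K n} (hf : ∀ j, shift K j f = f) (m : Fin n → ℕ) :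
    evalLattice m f = evalLattice 0 f := by
  induction hN : ∑ i, m i generalizing m with
  | zero =>
    have : m = 0 := by
      ext i
      simpa using Finset.sum_eq_zero_iff.mp hN i (Finset.mem_univ i)
    rw [this]
  | succ N ih =>
    obtain ⟨j, hj⟩ : ∃ j, m j ≠ 0 := by
      by_contra! hall
      simp [hall] at hN
    have hm : m = (m - Pi.single j 1) + Pi.single j 1 := by
      ext i
      by_cases hij : i = j
      · subst hij; simp; omega
      · simp [hij]
    rw [hm, ← evalLattice_shift, hf]
    refine ih _ ?_
    have : ∑ i, m i = ∑ i, ((m - Pi.single j 1 : Fin n → ℕ) i) + 1 := by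
      conv_lhs => rw [hm]
      simp [Finset.sum_add_distrib]
    omega

/-- The elements of `Ū(n)` invariant under all translations are the constants. -/
theorem exists_algebraMap_of_shift_eq {f : Ubar K n} (hf : ∀ j, shift K j f = f) :
    ∃ a : K, algebraMap K (Ubar K n) a = f := by
  refine ⟨evalLattice 0 f, ?_⟩
  set g := f - algebraMap K (Ubar K n) (evalLattice 0 f) with hg
  have hz : ∀ m, evalLattice m g = 0 := fun m => by
    simp [hg, evalLattice_of_shift_eq hf m]
  suffices g = 0 by rw [hg] at this; exact (sub_eq_zero.mp this).symm
  obtain ⟨p, d, e⟩ := IsLocalization.exists_mk'_eq (denominators K n) g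
  -- The numerator vanishes on a product of infinite sets, one arithmetic progression per
  -- coordinate; infinitude is where characteristic zero enters.
  have hp : p = 0 := by
    refine MvPolynomial.funext_set
      (fun i : Fin n => Set.range fun m : ℕ => ((i : ℕ) : K) / (n + 1 : ℕ) - m) (fun i => ?_) ?_
    · refine Set.infinite_range_of_injective fun a b hab => ?_
      simpa using hab
    · intro x hx
      choose m hm using fun i => hx i (Set.mem_univ i)
      have e' := congrArg (evalLattice m) (IsLocalization.mk'_spec (Ubar K n) p d)
      rw [e, map_mul, hz, zero_mul, evalLattice, evalAt_algebraMap] at e'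
      have : x = fun i : Fin n => ((i : ℕ) : K) / (n + 1 : ℕ) - m i := by
        ext i; exact (hm i).symm
      rw [this, map_zero]
      exact e'.symm
  rw [← e, hp, IsLocalization.mk'_zero]

theorem algebraMap_Ubar_injective : Function.Injective (algebraMap K (Ubar K n)) := by
  intro a b hab
  simpa using congrArg (evalLattice (0 : Fin n → ℕ)) hab

end Localization

/-! ### Identities between linear factors -/

section LinearFactors

variable {R : Type*} [CommRing R]

/-- The weights `-v (a - b)` and `v` add up to one and express `a` as an affine combination of `a -
1` and `b`; the factor `1 + c t` is affine in `c`. -/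
theorem linear_factor_identity (E : R[X]) {a b v : R} (hv : v * (1 - (a - b)) = 1) :
    (1 + C (a - 1) * X) * E * C (-(v * (a - b))) + (1 + C b * X) * E * C v =
      (1 + C a * X) * E := by
  have hv' := congrArg (C : R →+* R[X]) hv
  simp only [map_mul, map_sub, map_one, map_neg] at hv' ⊢
  linear_combination (1 + C a * X) * E * hv'

/-- The constant terms agree trivially, and the coefficient of `t` is exactly the hypothesis. -/
theorem linear_factor_difference (E : R[X]) {a b w w' : R}
    (hw : (a - b - 1) * w' = (a - b) * w) :
    (1 + C a * X) * E * C w - (1 + C (a - 1) * X) * E * C w' =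
      (1 + C b * X) * E * C (w - w') := by
  have hw' := congrArg (C : R →+* R[X]) hw
  simp only [map_mul, map_sub, map_one] at hw' ⊢
  linear_combination (-X * E) * hw'

theorem sum_add_sub_sum_add {ι : Type*} (s : Finset ι) (f g : ι → R[X]) (c d : R[X])
    (F : ι → R[X]) (hF : ∀ i, f i - g i = d * F i) :
    ∑ i ∈ s, f i + c - (∑ i ∈ s, g i + c) = d * ∑ i ∈ s, F i := by
  rw [add_sub_add_right_eq_sub, ← Finset.sum_sub_distrib, Finset.mul_sum]
  exact Finset.sum_congr rfl fun i _ => hF i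

end LinearFactors

/-! ### Translations of `e(t) / (1 + h̃ᵢ t)` and the explicit `ρ` -/

section Scalars

variable {K : Type*} [Field K] {n : ℕ}

theorem shift_hh (l i j : Fin n) : shift K l (hh K i j) =
    hh K i j - (if i = l then 1 else 0) + (if j = l then 1 else 0) := by
  simp only [hh, map_sub, shift_h]
  ring

theorem shift_hh_left {i j : Fin n} (hij : i ≠ j) : shift K i (hh K i j) = hh K i j - 1 := by
  simp [shift_hh, hij.symm]

theorem shift_hh_right {i j : Fin n} (hij : i ≠ j) : shift K j (hh K i j) = hh K i j + 1 := by
  simp [shift_hh, hij]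

theorem hh_swap (i j : Fin n) : hh K j i = -hh K i j := by simp [hh]

theorem isUnit_hh {i j : Fin n} (hij : i ≠ j) : IsUnit (hh K i j) := by
  simpa using isUnit_hh_add K hij 0

theorem isUnit_hh_sub {i j : Fin n} (hij : i ≠ j) (k : ℤ) : IsUnit (hh K i j - (k : Ubar K n)) := by
  simpa [sub_eq_add_neg] using isUnit_hh_add K hij (-k)

theorem isUnit_hh_sub_one {i j : Fin n} (hij : i ≠ j) : IsUnit (hh K i j - 1) := by
  simpa using isUnit_hh_sub (K := K) hij 1

theorem isUnit_hh_add_one {i j : Fin n} (hij : i ≠ j) : IsUnit (hh K i j + 1) := by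
  simpa using isUnit_hh_add K hij 1

theorem isUnit_one_sub_hh (i j : Fin n) : IsUnit (1 - hh K i j) := by
  rcases eq_or_ne i j with rfl | hij
  · simp [hh]
  · rw [← neg_sub]
    exact (isUnit_hh_sub_one hij).neg

theorem map_ringInverse {A B : Type*} [CommRing A] [CommRing B] [Algebra K A] [Algebra K B]
    (φ : A →ₐ[K] B) {a : A} (ha : IsUnit a) : φ (Ring.inverse a) = Ring.inverse (φ a) := by
  refine (ha.map φ).mul_right_cancel ?_
  rw [Ring.inverse_mul_cancel _ (ha.map φ), ← map_mul, Ring.inverse_mul_cancel _ ha, map_one]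

variable (K) in
/-- The factor `h̃ᵢⱼ / (h̃ᵢⱼ - 1)` in `xⁱ Γⱼ = h̃ᵢⱼ / (h̃ᵢⱼ - 1) Γⱼ xⁱ` for `i ≠ j`. -/
noncomputable def gamFactor (i j : Fin n) : Ubar K n := hh K i j * Ring.inverse (hh K i j - 1)

theorem gamFactor_mul {i j : Fin n} (hij : i ≠ j) :
    gamFactor K i j * (hh K i j - 1) = hh K i j := by
  rw [gamFactor, mul_assoc, Ring.inverse_mul_cancel _ (isUnit_hh_sub_one hij), mul_one]

theorem map_one_add_C_mul_X (φ : Ubar K n →ₐ[K] Ubar K n) (a : Ubar K n) :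
    (1 + C a * X : (Ubar K n)[X]).map (φ : Ubar K n →+* Ubar K n) = 1 + C (φ a) * X := by
  simp

/-- The polynomial `e(t) / ((1 + h̃ᵢ t) (1 + h̃ⱼ t))` for `i ≠ j`. -/
theorem exists_eDiv_eq {i j : Fin n} (hij : i ≠ j) : ∃ E : (Ubar K n)[X],
    eDiv K i = (1 + C (h K j) * X) * E ∧ eDiv K j = (1 + C (h K i) * X) * E ∧
      E.map (shift K j : Ubar K n →+* Ubar K n) = E := by
  refine ⟨∏ k ∈ (Finset.univ.erase i).erase j, (1 + C (h K k) * X), ?_, ?_, ?_⟩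
  · exact (Finset.mul_prod_erase _ (fun k => 1 + C (h K k) * X)
      (Finset.mem_erase.mpr ⟨hij.symm, Finset.mem_univ j⟩)).symm
  · rw [Finset.erase_right_comm]
    exact (Finset.mul_prod_erase _ (fun k => 1 + C (h K k) * X)
      (Finset.mem_erase.mpr ⟨hij, Finset.mem_univ i⟩)).symm
  · rw [Polynomial.map_prod]
    refine Finset.prod_congr rfl fun k hk => ?_
    rw [map_one_add_C_mul_X, shift_h, if_neg (Finset.ne_of_mem_erase hk), sub_zero]

theorem map_shift_eDiv_self (j : Fin n) :
    (eDiv K j).map (shift K j : Ubar K n →+* Ubar K n) = eDiv K j := by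
  rw [eDiv, Polynomial.map_prod]
  refine Finset.prod_congr rfl fun k hk => ?_
  rw [map_one_add_C_mul_X, shift_h, if_neg (Finset.ne_of_mem_erase hk), sub_zero]

/-- This is the identity behind centrality: `gamFactor` is what `Γᵢ` acquires when `xʲ` passes it,
and `1 / (1 - h̃ⱼᵢ)` is the coefficient of `Γᵢ` in `xʲ ∂̄ⱼ`. -/
theorem map_shift_eDiv_mul_gamFactor {i j : Fin n} (hij : j ≠ i) :
    (eDiv K i).map (shift K j : Ubar K n →+* Ubar K n) * C (gamFactor K j i) +
      eDiv K j * C (Ring.inverse (1 - hh K j i)) = eDiv K i := by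
  obtain ⟨E, hi, hj, hE⟩ := exists_eDiv_eq (K := K) hij.symm
  have hv := Ring.inverse_mul_cancel _ (isUnit_one_sub_hh (K := K) j i)
  have hq := gamFactor_mul (K := K) hij
  set v := Ring.inverse (1 - hh K j i)
  have hq' : gamFactor K j i = -(v * hh K j i) := by
    linear_combination (-v) * hq - gamFactor K j i * hv
  rw [hq', hi, Polynomial.map_mul, map_one_add_C_mul_X, hE, shift_h, if_pos rfl, hj]
  exact linear_factor_identity E hv

/-- The hypothesis says that `w` depends on `h̃ⱼ` only through a factor `1 / h̃ⱼₖ`, as `π(h̃ₖ) / χₖ`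
does. -/
theorem delta_eDiv_mul {j k : Fin n} (hjk : j ≠ k) (w : Ubar K n)
    (hw : shift K j (hh K j k * w) = hh K j k * w) :
    eDiv K k * C w - (eDiv K k * C w).map (shift K j : Ubar K n →+* Ubar K n) =
      eDiv K j * C (delta j w) := by
  obtain ⟨E, hk, hj, hE⟩ := exists_eDiv_eq (K := K) hjk.symm
  rw [map_mul, shift_hh_left hjk] at hw
  rw [hk, hj, Polynomial.map_mul, Polynomial.map_mul, map_one_add_C_mul_X, hE, shift_h,
    if_pos rfl, Polynomial.map_C, delta]
  exact linear_factor_difference E hw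

theorem shift_aeval_h_of_ne {j k : Fin n} (hjk : j ≠ k) (q : K[X]) :
    shift K j (aeval (h K k) q) = aeval (h K k) q := by
  rw [← Polynomial.aeval_algHom_apply, shift_h, if_neg hjk.symm, sub_zero]

/-- Multiplication by `h̃ⱼₖ` cancels, up to sign, the only factor of `χₖ` that involves `h̃ⱼ`. -/
theorem shift_hh_mul_toW {j k : Fin n} (hjk : j ≠ k) (q : K[X]) :
    shift K j (hh K j k * toW K k q) = hh K j k * toW K k q := by
  obtain ⟨c, hc, hinv⟩ : ∃ c : Ubar K n, chi K k = hh K k j * c ∧ shift K j c = c := by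
    refine ⟨∏ l ∈ (Finset.univ.erase k).erase j, hh K k l,
      (Finset.mul_prod_erase _ (fun l => hh K k l)
        (Finset.mem_erase.mpr ⟨hjk, Finset.mem_univ j⟩)).symm, ?_⟩
    rw [map_prod]
    refine Finset.prod_congr rfl fun l hl => ?_
    rw [shift_hh, if_neg hjk.symm, if_neg (Finset.ne_of_mem_erase hl)]
    ring
  have hcu : IsUnit c := by
    have := isUnit_chi K k
    rw [hc] at this
    exact isUnit_of_mul_isUnit_right this
  have e : (hh K j k * toW K k q) * c = -aeval (h K k) q := by
    rw [← toW_mul_chi, hc, hh_swap k j]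
    ring
  have e' := congrArg (shift K j) e
  rw [map_mul, hinv, map_neg, shift_aeval_h_of_ne hjk, ← e] at e'
  exact hcu.mul_right_cancel e'

theorem natDegree_eDiv_le (i : Fin n) : (eDiv K i).natDegree ≤ n - 1 := by
  refine (natDegree_prod_le _ _).trans ?_
  refine (Finset.sum_le_card_nsmul _ _ 1 fun k _ => ?_).trans (by simp)
  compute_degree

theorem degree_eDiv_lt (i : Fin n) : (eDiv K i).degree < n := by
  refine degree_le_natDegree.trans_lt ?_
  have := natDegree_eDiv_le (K := K) i
  have hi := i.2
  exact_mod_cast (by omega : (eDiv K i).natDegree < n)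

/-- The explicit polynomial is admissible for the potential `∑ₖ πₖ(h̃ₖ) / χₖ`. -/
theorem isRho_explicitRho (q : Fin n → K[X]) (p : K[X]) (hp : p.degree < n) :
    IsRho (∑ k, toW K k (q k)) (explicitRho q p) where
  degree_lt := by
    refine (degree_add_le _ _).trans_lt (max_lt ?_ ?_)
    · refine (degree_sum_le _ _).trans_lt ((Finset.sup_lt_iff (WithBot.bot_lt_coe n)).mpr ?_)
      intro k _
      refine (degree_mul_le _ _).trans_lt ?_
      exact (add_le_add_right degree_C_le _).trans_lt (by rw [add_zero]; exact degree_eDiv_lt k)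
    · exact degree_map_le.trans_lt hp
  difference j := by
    have hconst : (p.map (algebraMap K (Ubar K n))).map (shift K j : Ubar K n →+* Ubar K n) =
        p.map (algebraMap K (Ubar K n)) := by
      rw [Polynomial.map_map, AlgHom.comp_algebraMap]
    have hterm : ∀ k, eDiv K k * C (toW K k (q k)) -
        (eDiv K k * C (toW K k (q k))).map (shift K j : Ubar K n →+* Ubar K n) =
          eDiv K j * C (delta j (toW K k (q k))) := by
      intro k
      rcases eq_or_ne j k with rfl | hjk
      · rw [Polynomial.map_mul, map_shift_eDiv_self, Polynomial.map_C, delta, C_sub]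
        exact (mul_sub (eDiv K j) _ _).symm
      · exact delta_eDiv_mul hjk _ (shift_hh_mul_toW hjk _)
    have hd : delta j (∑ k, toW K k (q k)) = ∑ k, delta j (toW K k (q k)) := by
      simp [delta]
    rw [explicitRho, Polynomial.map_add, hconst, Polynomial.map_sum, hd, map_sum]
    exact sum_add_sub_sum_add (R := Ubar K n) _ _ _ _ _ _ hterm

theorem exists_of_mem_W {σ : Ubar K n} (hσ : σ ∈ W K n) :
    ∃ q : Fin n → K[X], σ = ∑ k, toW K k (q k) := by
  obtain ⟨f, hf, rfl⟩ := (Submodule.mem_iSup_iff_exists_finsupp _ _).mp hσ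
  choose q hq using hf
  exact ⟨q, by rw [Finsupp.sum_fintype _ _ fun _ => rfl]; exact Finset.sum_congr rfl fun k _ =>
    (hq k).symm⟩

/-! ### Lagrange interpolation for the polynomials `e(t) / (1 + h̃ᵢ t)` -/

section Lagrange

/-- The interpolation nodes are `t = -1 / h̃ⱼ`, but `h̃ⱼ` need not be invertible in `Ū(n)`. The
reflected polynomial `u ^ N p(1 / u)` is evaluated at `u = -h̃ⱼ` instead. -/
theorem sum_coeff_mul_pow_eq_eval_reflect {R : Type*} [CommRing R] (p : R[X]) (u : R) {N : ℕ}
    (hp : p.natDegree ≤ N) :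
    ∑ k ∈ Finset.range (N + 1), p.coeff k * u ^ (N - k) = eval u (reflect N p) := by
  have hd : (reflect N p).natDegree < N + 1 := by
    rw [Nat.lt_succ_iff, natDegree_le_iff_coeff_eq_zero]
    intro m hm
    rw [coeff_reflect, revAt_eq_self_of_lt hm, coeff_eq_zero_of_natDegree_lt (by omega)]
  rw [eval_eq_sum_range' hd, ← Finset.sum_range_reflect]
  refine Finset.sum_congr rfl fun k hk => ?_
  have hk' : k ≤ N := Nat.lt_succ_iff.mp (Finset.mem_range.mp hk)
  rw [coeff_reflect, revAt_le hk']
  congr 2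
  omega

theorem reflect_prod_one_add {R ι : Type*} [CommRing R] [DecidableEq ι] (s : Finset ι) (a : ι → R) :
    reflect s.card (∏ k ∈ s, (1 + C (a k) * X)) = ∏ k ∈ s, (X + C (a k)) := by
  induction s using Finset.induction_on with
  | empty => simp
  | insert i s hi ih =>
    have h1 : (1 + C (a i) * X : R[X]).natDegree ≤ 1 := by compute_degree
    have h2 : (∏ k ∈ s, (1 + C (a k) * X)).natDegree ≤ s.card := by
      refine (natDegree_prod_le _ _).trans
        ((Finset.sum_le_card_nsmul _ _ 1 fun k _ => ?_).trans (by simp))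
      compute_degree
    rw [Finset.prod_insert hi, Finset.prod_insert hi, Finset.card_insert_of_notMem hi, add_comm,
      reflect_mul _ _ h1 h2, ih]
    congr 1
    ext m
    rw [coeff_reflect]
    rcases m with _ | _ | m
    · rw [revAt_le (by omega)]
      simp [coeff_one]
    · rw [revAt_le (by omega)]
      simp [coeff_C]
    · rw [revAt_eq_self_of_lt (by omega)]
      simp [coeff_one, coeff_X]

variable (K n) in
/-- The coefficients of the polynomials `e(t) / (1 + h̃ᵢ t)`. -/
noncomputable def eMatrix : Matrix (Fin n) (Fin n) (Ubar K n) :=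
  Matrix.of fun k i => (eDiv K i).coeff k

variable (K n) in
/-- The inverse of `eMatrix`. -/
noncomputable def eInv : Matrix (Fin n) (Fin n) (Ubar K n) :=
  Matrix.of fun j k => Ring.inverse (∏ l ∈ Finset.univ.erase j, hh K l j) *
    (-h K j) ^ (n - 1 - (k : ℕ))

/-- Up to normalization the `(j, i)` entry is `∏_{l ≠ i} h̃ₗⱼ`, which contains the zero factor `l =
j` as soon as `i ≠ j`. -/
theorem eInv_mul_eMatrix : eInv K n * eMatrix K n = 1 := by
  ext j i
  have hn : n - 1 + 1 = n := by have := i.2; omega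
  have hcard : (Finset.univ.erase i).card = n - 1 := by simp
  have e : ∑ k : Fin n, (eDiv K i).coeff k * (-h K j) ^ (n - 1 - (k : ℕ)) =
      ∏ l ∈ Finset.univ.erase i, hh K l j := by
    rw [Fin.sum_univ_eq_sum_range (fun k => (eDiv K i).coeff k * (-h K j) ^ (n - 1 - k)) n]
    have := sum_coeff_mul_pow_eq_eval_reflect (eDiv K i) (-h K j) (natDegree_eDiv_le i)
    rw [hn] at this
    rw [this, ← hcard, eDiv, reflect_prod_one_add, eval_prod]
    refine Finset.prod_congr rfl fun l _ => ?_
    simp [hh]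
    ring
  have e' : (eInv K n * eMatrix K n) j i = Ring.inverse (∏ l ∈ Finset.univ.erase j, hh K l j) *
      ∏ l ∈ Finset.univ.erase i, hh K l j := by
    rw [← e, Matrix.mul_apply, Finset.mul_sum]
    refine Finset.sum_congr rfl fun k _ => ?_
    simp only [eInv, eMatrix, Matrix.of_apply]
    ring
  rw [e', Matrix.one_apply]
  split_ifs with hji
  · subst hji
    refine Ring.inverse_mul_cancel _ ?_
    exact Finset.prod_induction _ IsUnit (fun _ _ => IsUnit.mul) isUnit_one fun k hk =>
      isUnit_hh (Finset.ne_of_mem_erase hk)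
  · rw [Finset.prod_eq_zero (s := Finset.univ.erase i) (i := j) (by simp [hji]) (by simp [hh]),
      mul_zero]

theorem eMatrix_mul_eInv : eMatrix K n * eInv K n = 1 :=
  mul_eq_one_comm.mp eInv_mul_eMatrix

end Lagrange

end Scalars

/-! ### Compatibility of the exchange factors -/

section ExchangeFactors

variable {K : Type*} [Field K] {n : ℕ}

theorem shift_gamFactor_right {i j : Fin n} (hij : i ≠ j) :
    shift K j (gamFactor K i j) = (hh K i j + 1) * Ring.inverse (hh K i j) := by
  rw [Ring.eq_mul_inverse_iff_mul_eq _ _ _ (isUnit_hh hij)]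
  have := congrArg (shift K j) (gamFactor_mul hij)
  rwa [map_mul, map_sub, map_one, shift_hh_right hij, add_sub_cancel_right] at this

theorem mul_ringInverse_mul {R : Type*} [CommRing R] {a b : R} (hb : IsUnit b) :
    a * Ring.inverse b * b = a := by
  rw [mul_assoc, Ring.inverse_mul_cancel _ hb, mul_one]

theorem isUnit_hh_add_one_div {i j : Fin n} (hij : i ≠ j) :
    IsUnit ((hh K i j + 1) * Ring.inverse (hh K i j)) :=
  (isUnit_hh_add_one hij).mul (isUnit_hh hij).ringInverse

theorem isUnit_hh_sub_one_div {i j : Fin n} (hij : i ≠ j) :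
    IsUnit ((hh K i j - 1) * Ring.inverse (hh K i j)) :=
  (isUnit_hh_sub_one hij).mul (isUnit_hh hij).ringInverse

theorem isUnit_xdFactor {i j : Fin n} (hij : i ≠ j) :
    IsUnit (hh K i j * (hh K i j - 2) * Ring.inverse ((hh K i j - 1) ^ 2)) := by
  have h2 : IsUnit (hh K i j - 2) := by simpa using isUnit_hh_sub (K := K) hij 2
  exact ((isUnit_hh hij).mul h2).mul ((isUnit_hh_sub_one hij).pow 2).ringInverse

theorem gamFactor_mul_swap {i j : Fin n} (hij : i ≠ j) :
    gamFactor K i j * ((hh K j i + 1) * Ring.inverse (hh K j i)) = 1 := by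
  refine (isUnit_hh hij.symm).mul_right_cancel ((isUnit_hh_sub_one hij).mul_right_cancel ?_)
  rw [← mul_assoc, mul_assoc (_ * _) (Ring.inverse _), Ring.inverse_mul_cancel _ (isUnit_hh hij.symm)]
  have := gamFactor_mul (K := K) hij
  rw [hh_swap i j]
  linear_combination (-hh K i j + 1) * this

/-- The relation between the factors for `xⁱ ∂̄ⱼ` and `xⁱ xʲ` with `i > j`. -/
theorem exists_shift_eq_gamFactor {i j : Fin n} (hij : i ≠ j) : ∃ f : Ubar K n,
    shift K j f = gamFactor K i j ∧
      hh K i j * (hh K i j - 2) * Ring.inverse ((hh K i j - 1) ^ 2) * f = gamFactor K i j := by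
  obtain ⟨f, hf⟩ := shift_surjective j (gamFactor K i j)
  refine ⟨f, hf, ?_⟩
  have h2 : IsUnit (hh K i j - 2) := by simpa using isUnit_hh_sub (K := K) hij 2
  have e : f * (hh K i j - 2) = hh K i j - 1 := by
    apply (shiftEquiv K j).injective
    have h3 := gamFactor_mul (K := K) hij
    simp only [shiftEquiv_apply, map_mul, map_sub, map_one, hf, shift_hh_right hij,
      map_ofNat]
    linear_combination h3
  have hq := gamFactor_mul (K := K) hij
  refine ((isUnit_hh_sub_one hij).pow 2).mul_right_cancel ?_
  have := mul_ringInverse_mul (a := hh K i j * (hh K i j - 2)) ((isUnit_hh_sub_one (K := K) hij).pow 2)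
  linear_combination f * this + hh K i j * e - (hh K i j - 1) * hq

theorem shift_hh_sub_one_div {i j : Fin n} (hij : i ≠ j) :
    shift K j ((hh K i j - 1) * Ring.inverse (hh K i j)) = gamFactor K j i := by
  have h1 := congrArg (shift K j) (mul_ringInverse_mul (a := hh K i j - 1) (isUnit_hh (K := K) hij))
  simp only [map_mul, map_sub, map_one, shift_hh_right hij] at h1
  rw [map_mul, map_sub, map_one, shift_hh_right hij]
  refine (isUnit_hh_add_one hij).mul_right_cancel ?_
  rw [h1]
  have h2 := gamFactor_mul (K := K) hij.symm
  rw [hh_swap i j] at h2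
  linear_combination h2

/-- The nontrivial factor between `xⁱ` and `∂̄ⱼ` has to match the factors between `∂̄ᵢ` and `∂̄ⱼ`
for `Γᵢ` to pass `∂̄ⱼ` by one rule in both orders of the indices. -/
theorem shift_mul_div_eq_xdFactor {i j : Fin n} (hij : i ≠ j) :
    shift K i ((hh K i j - 1) * Ring.inverse (hh K i j) *
      ((hh K j i - 1) * Ring.inverse (hh K j i))) =
      hh K i j * (hh K i j - 2) * Ring.inverse ((hh K i j - 1) ^ 2) := by
  rw [Ring.eq_mul_inverse_iff_mul_eq _ _ _ ((isUnit_hh_sub_one hij).pow 2)]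
  have h1 := congrArg (shift K i) (mul_ringInverse_mul (a := hh K i j - 1) (isUnit_hh (K := K) hij))
  have h2 := congrArg (shift K i)
    (mul_ringInverse_mul (a := hh K j i - 1) (isUnit_hh (K := K) hij.symm))
  rw [map_mul, map_sub, map_one, shift_hh_left hij] at h1
  rw [map_mul, map_sub, map_one, shift_hh_right hij.symm, hh_swap i j] at h2
  rw [hh_swap i j, map_mul]
  set A := shift K i ((hh K i j - 1) * Ring.inverse (hh K i j))
  set B := shift K i ((-hh K i j - 1) * Ring.inverse (-hh K i j))
  linear_combination (B * (hh K i j - 1)) * h1 - (hh K i j - 2) * h2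

end ExchangeFactors

/-! ### Commutation rules in the algebra -/

section Relations

variable {K : Type*} [Field K] {n : ℕ} (s : Fin n → Ubar K n)

/-- The generator `xⁱ` of `Diff_h(σ₁, …, σₙ)`. -/
def xGen (i : Fin n) : Diff s := RingQuot.mkAlgHom K (Rel s) (fx K i)

/-- The generator `∂̄ᵢ` of `Diff_h(σ₁, …, σₙ)`. -/
def dGen (i : Fin n) : Diff s := RingQuot.mkAlgHom K (Rel s) (fd K i)

theorem Gam_eq (i : Fin n) : Gam s i = dGen s i * xGen s i := rfl

theorem mk_fc (f : Ubar K n) : RingQuot.mkAlgHom K (Rel s) (fc f) = coeffHom s f := rfl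

theorem mk_fx (i : Fin n) : RingQuot.mkAlgHom K (Rel s) (fx K i) = xGen s i := rfl

theorem mk_fd (i : Fin n) : RingQuot.mkAlgHom K (Rel s) (fd K i) = dGen s i := rfl

theorem xGen_mul_coeffHom (j : Fin n) (f : Ubar K n) :
    xGen s j * coeffHom s f = coeffHom s (shift K j f) * xGen s j := by
  refine intertwine_of_h (coeffHom s) ((coeffHom s).comp (shift K j)) _ (fun i => ?_) f
  have := RingQuot.mkAlgHom_rel K (Rel.weight_x (s := s) i j)
  simp only [map_mul, mk_fc, mk_fx, map_add, apply_ite_one] at this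
  rw [AlgHom.comp_apply, shift_h, map_sub, apply_ite_one, sub_mul, this, mul_add]
  split_ifs <;> simp

theorem dGen_mul_coeffHom_shift (j : Fin n) (f : Ubar K n) :
    dGen s j * coeffHom s (shift K j f) = coeffHom s f * dGen s j := by
  refine intertwine_of_h ((coeffHom s).comp (shift K j)) (coeffHom s) _ (fun i => ?_) f
  have := RingQuot.mkAlgHom_rel K (Rel.weight_d (s := s) i j)
  simp only [map_mul, mk_fc, mk_fd] at this
  rw [AlgHom.comp_apply, shift_h, this]

theorem Gam_mul_coeffHom (i : Fin n) (f : Ubar K n) :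
    Gam s i * coeffHom s f = coeffHom s f * Gam s i := by
  rw [Gam_eq, mul_assoc, xGen_mul_coeffHom, ← mul_assoc, dGen_mul_coeffHom_shift, mul_assoc]

variable {s} in
/-- An element commutes with another one up to a scalar: move the scalar to the other side. -/
theorem eq_coeffHom_inverse_mul {f : Ubar K n} (hf : IsUnit f) {a b : Diff s}
    (hab : a = coeffHom s f * b) : b = coeffHom s (Ring.inverse f) * a := by
  rw [hab, ← mul_assoc, ← map_mul, Ring.inverse_mul_cancel _ hf, map_one, one_mul]

theorem xGen_mul_xGen_of_lt {i j : Fin n} (hij : i < j) : xGen s i * xGen s j =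
    coeffHom s ((hh K i j + 1) * Ring.inverse (hh K i j)) * (xGen s j * xGen s i) := by
  simpa only [map_mul, mk_fc, mk_fx] using
    RingQuot.mkAlgHom_rel K (Rel.x_x (s := s) i j hij)

theorem dGen_mul_dGen_of_lt {i j : Fin n} (hij : i < j) : dGen s i * dGen s j =
    coeffHom s ((hh K i j - 1) * Ring.inverse (hh K i j)) * (dGen s j * dGen s i) := by
  simpa only [map_mul, mk_fc, mk_fd] using
    RingQuot.mkAlgHom_rel K (Rel.d_d (s := s) i j hij)

theorem xGen_mul_dGen_of_lt {i j : Fin n} (hij : i < j) :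
    xGen s i * dGen s j = dGen s j * xGen s i := by
  simpa only [map_mul, mk_fx, mk_fd] using
    RingQuot.mkAlgHom_rel K (Rel.x_d_lt (s := s) i j hij)

theorem xGen_mul_dGen_of_gt {i j : Fin n} (hij : j < i) : xGen s i * dGen s j =
    coeffHom s (hh K i j * (hh K i j - 2) * Ring.inverse ((hh K i j - 1) ^ 2)) *
      (dGen s j * xGen s i) := by
  simpa only [map_mul, mk_fc, mk_fx, mk_fd] using
    RingQuot.mkAlgHom_rel K (Rel.x_d_gt (s := s) i j hij)

theorem xGen_mul_dGen_self (i : Fin n) : xGen s i * dGen s i =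
    ∑ j, coeffHom s (Ring.inverse (1 - hh K i j)) * Gam s j - coeffHom s (s i) := by
  simpa only [map_mul, map_sub, map_sum, mk_fc, mk_fx, mk_fd, Gam_eq] using
    RingQuot.mkAlgHom_rel K (Rel.x_d_same (s := s) i)

theorem exists_xGen_mul_xGen {i j : Fin n} (hij : i ≠ j) : ∃ f,
    xGen s i * xGen s j = coeffHom s f * (xGen s j * xGen s i) := by
  rcases hij.lt_or_gt with hlt | hlt
  · exact ⟨_, xGen_mul_xGen_of_lt s hlt⟩
  · exact ⟨_, eq_coeffHom_inverse_mul (isUnit_hh_add_one_div hlt.ne) (xGen_mul_xGen_of_lt s hlt)⟩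

theorem exists_dGen_mul_dGen {i j : Fin n} (hij : i ≠ j) : ∃ f,
    dGen s i * dGen s j = coeffHom s f * (dGen s j * dGen s i) := by
  rcases hij.lt_or_gt with hlt | hlt
  · exact ⟨_, dGen_mul_dGen_of_lt s hlt⟩
  · exact ⟨_, eq_coeffHom_inverse_mul (isUnit_hh_sub_one_div hlt.ne) (dGen_mul_dGen_of_lt s hlt)⟩

theorem exists_xGen_mul_dGen {i j : Fin n} (hij : i ≠ j) : ∃ f, IsUnit f ∧
    xGen s i * dGen s j = coeffHom s f * (dGen s j * xGen s i) := by
  rcases hij.lt_or_gt with hlt | hlt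
  · exact ⟨1, isUnit_one, by rw [map_one, one_mul, xGen_mul_dGen_of_lt s hlt]⟩
  · exact ⟨_, isUnit_xdFactor hij, xGen_mul_dGen_of_gt s hlt⟩

theorem exists_dGen_mul_xGen {i j : Fin n} (hij : i ≠ j) : ∃ f,
    dGen s i * xGen s j = coeffHom s f * (xGen s j * dGen s i) := by
  obtain ⟨f, hf, e⟩ := exists_xGen_mul_dGen s hij.symm
  exact ⟨_, eq_coeffHom_inverse_mul hf e⟩

theorem xGen_mul_xGen_of_gt {i j : Fin n} (hij : j < i) : xGen s i * xGen s j =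
    coeffHom s (gamFactor K i j) * (xGen s j * xGen s i) := by
  rw [xGen_mul_xGen_of_lt s hij, ← mul_assoc, ← map_mul, gamFactor_mul_swap hij.ne', map_one,
    one_mul]

/-- For `i < j` the factor comes only from `xⁱ xʲ`, translated while crossing `∂̄ⱼ`. For `i > j` the
factors of `xⁱ ∂̄ⱼ` and `xⁱ xʲ` combine to the same value. -/
theorem xGen_mul_Gam_of_ne {i j : Fin n} (hij : i ≠ j) :
    xGen s i * Gam s j = coeffHom s (gamFactor K i j) * Gam s j * xGen s i := by
  rw [Gam_eq, ← mul_assoc]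
  rcases hij.lt_or_gt with hlt | hlt
  · rw [xGen_mul_dGen_of_lt s hlt, mul_assoc, xGen_mul_xGen_of_lt s hlt,
      ← shift_gamFactor_right hij, ← mul_assoc, dGen_mul_coeffHom_shift]
    simp only [mul_assoc]
  · obtain ⟨f, hf, e⟩ := exists_shift_eq_gamFactor (K := K) hij
    rw [xGen_mul_dGen_of_gt s hlt, mul_assoc (coeffHom s _) (dGen s j * xGen s i),
      mul_assoc (dGen s j) (xGen s i), xGen_mul_xGen_of_gt s hlt, ← hf,
      ← mul_assoc (dGen s j), dGen_mul_coeffHom_shift, mul_assoc (coeffHom s f), ← mul_assoc,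
      ← map_mul, e, hf]
    simp only [mul_assoc]

theorem Gam_mul_dGen_of_ne {i j : Fin n} (hij : j ≠ i) :
    dGen s j * (coeffHom s (gamFactor K j i) * Gam s i) = Gam s i * dGen s j := by
  have key : ∀ a, dGen s j * (coeffHom s (gamFactor K j i) * a) =
      coeffHom s ((hh K i j - 1) * Ring.inverse (hh K i j)) * (dGen s j * a) := fun a => by
    rw [← mul_assoc, ← shift_hh_sub_one_div hij.symm, dGen_mul_coeffHom_shift, mul_assoc]
  rw [key, Gam_eq, mul_assoc (dGen s i)]
  rcases hij.lt_or_gt with hlt | hlt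
  · rw [xGen_mul_dGen_of_gt s hlt, ← shift_mul_div_eq_xdFactor hij.symm, ← mul_assoc (dGen s i),
      dGen_mul_coeffHom_shift, ← mul_assoc (dGen s j), dGen_mul_dGen_of_lt s hlt]
    simp only [map_mul, mul_assoc]
  · rw [xGen_mul_dGen_of_lt s hlt, ← mul_assoc (dGen s i), dGen_mul_dGen_of_lt s hlt]
    simp only [mul_assoc]

variable {s} in
theorem Diff.induction {motive : Diff s → Prop} (coeff : ∀ f, motive (coeffHom s f))
    (x : ∀ i, motive (xGen s i)) (d : ∀ i, motive (dGen s i))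
    (mul : ∀ a b, motive a → motive b → motive (a * b))
    (add : ∀ a b, motive a → motive b → motive (a + b)) (a : Diff s) : motive a := by
  obtain ⟨a, rfl⟩ := RingQuot.mkAlgHom_surjective K (Rel s) a
  induction a using FreeAlgebra.induction with
  | grade0 r =>
    rw [AlgHom.commutes, ← AlgHom.commutes (coeffHom s)]
    exact coeff _
  | grade1 g =>
    cases g with
    | coeff f => exact coeff f
    | x i => exact x i
    | d i => exact d i
  | mul a b ha hb => rw [map_mul]; exact mul _ _ ha hb
  | add a b ha hb => rw [map_add]; exact add _ _ ha hb

theorem mem_center_of_commute {y : Diff s} (hc : ∀ f, Commute (coeffHom s f) y)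
    (hx : ∀ i, Commute (xGen s i) y) (hd : ∀ i, Commute (dGen s i) y) :
    y ∈ Subalgebra.center K (Diff s) := by
  rw [Subalgebra.mem_center_iff]
  intro b
  change Commute b y
  induction b using Diff.induction with
  | coeff f => exact hc f
  | x i => exact hx i
  | d i => exact hd i
  | mul a b ha hb => exact ha.mul_left hb
  | add a b ha hb => exact ha.add_left hb

end Relations

/-! ### Centrality of the coefficients of `c(t)` -/

section Central

variable {K : Type*} [Field K] {n : ℕ}

theorem coeff_shift_mul_gamFactor {i j : Fin n} (hij : j ≠ i) (k : ℕ) :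
    shift K j ((eDiv K i).coeff k) * gamFactor K j i +
      (eDiv K j).coeff k * Ring.inverse (1 - hh K j i) = (eDiv K i).coeff k := by
  have := congrArg (fun p : (Ubar K n)[X] => p.coeff k) (map_shift_eDiv_mul_gamFactor (K := K) hij)
  simpa only [coeff_add, coeff_mul_C, coeff_map, RingHom.coe_coe] using this

theorem shift_coeff_eDiv_self (j : Fin n) (k : ℕ) :
    shift K j ((eDiv K j).coeff k) = (eDiv K j).coeff k := by
  have := congrArg (fun p : (Ubar K n)[X] => p.coeff k) (map_shift_eDiv_self (K := K) j)
  simpa only [coeff_map, RingHom.coe_coe] using this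

/-- The coefficients of `c(t)` do not change when `Γ` is replaced by its `j`-th translate. -/
theorem sum_shift_eDiv_mul {B : Type*} [Ring B] [Algebra K B] (φ : Ubar K n →ₐ[K] B)
    (G : Fin n → B) (j : Fin n) (k : ℕ) {a r : Ubar K n}
    (hr : r - shift K j r = (eDiv K j).coeff k * a) :
    ∑ i, φ (shift K j ((eDiv K i).coeff k)) *
      (if j = i then ∑ l, φ (Ring.inverse (1 - hh K j l)) * G l - φ a else
        φ (gamFactor K j i) * G i) - φ (shift K j r) =
      ∑ i, φ ((eDiv K i).coeff k) * G i - φ r := by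
  have hj : φ (shift K j r) = φ r - φ ((eDiv K j).coeff k) * φ a := by
    rw [← map_mul, ← hr, map_sub, sub_sub_cancel]
  -- Each `i ≠ j` leaves a defect proportional to the `j`-th coefficient. Together these cancel the
  -- sum over `l ≠ j` in the term `i = j`.
  have e : ∀ i ∈ Finset.univ.erase j, φ (shift K j ((eDiv K i).coeff k)) *
      (if j = i then ∑ l, φ (Ring.inverse (1 - hh K j l)) * G l - φ a else
        φ (gamFactor K j i) * G i) = φ ((eDiv K i).coeff k) * G i -
          φ ((eDiv K j).coeff k) * (φ (Ring.inverse (1 - hh K j i)) * G i) := by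
    intro i hi
    have hji := (Finset.ne_of_mem_erase hi).symm
    rw [if_neg hji]
    conv_rhs => rw [← coeff_shift_mul_gamFactor hji]
    simp only [map_add, map_mul]
    noncomm_ring
  have hs : ∑ l, φ (Ring.inverse (1 - hh K j l)) * G l =
      G j + ∑ l ∈ Finset.univ.erase j, φ (Ring.inverse (1 - hh K j l)) * G l := by
    rw [← Finset.add_sum_erase _ _ (Finset.mem_univ j)]
    simp [hh]
  rw [← Finset.add_sum_erase _ _ (Finset.mem_univ j), Finset.sum_congr rfl e, if_pos rfl,
    shift_coeff_eDiv_self, hj, ← Finset.add_sum_erase _ (fun i => φ ((eDiv K i).coeff k) * G i)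
      (Finset.mem_univ j), Finset.sum_sub_distrib, ← Finset.mul_sum, hs]
  noncomm_ring

variable (s : Fin n → Ubar K n) (ρ : (Ubar K n)[X])

theorem coeff_cPoly (k : ℕ) : (cPoly s ρ).coeff k =
    ∑ i, coeffHom s ((eDiv K i).coeff k) * Gam s i - coeffHom s (ρ.coeff k) := by
  simp only [cPoly, coeff_sub, finsetSum_coeff, coeff_mul_C, coeff_map, RingHom.coe_coe]

variable {ρ}

theorem coeff_cPoly_mem_center
    (hρ : ∀ j (k : ℕ), ρ.coeff k - shift K j (ρ.coeff k) = (eDiv K j).coeff k * s j) (k : ℕ) :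
    (cPoly s ρ).coeff k ∈ Subalgebra.center K (Diff s) := by
  have alt := fun j => sum_shift_eDiv_mul (coeffHom s) (Gam s) j k (hρ j k)
  refine mem_center_of_commute s (fun f => ?_) (fun j => ?_) (fun j => ?_)
  · rw [coeff_cPoly]
    refine Commute.sub_right (Commute.sum_right _ _ _ fun i _ => ?_) ((Commute.all _ _).map _)
    exact ((Commute.all _ _).map _).mul_right (Gam_mul_coeffHom s i f).symm
  · change _ * _ = _ * _
    rw [coeff_cPoly]
    -- With `c_k` on the right written through translated coefficients, both sides agree term by
    -- term.
    conv_rhs => rw [← alt j]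
    rw [mul_sub, sub_mul, xGen_mul_coeffHom, Finset.mul_sum, Finset.sum_mul]
    congr 1
    refine Finset.sum_congr rfl fun i _ => ?_
    rw [← mul_assoc, xGen_mul_coeffHom, mul_assoc, mul_assoc]
    congr 1
    split_ifs with hji
    · subst hji
      rw [← xGen_mul_dGen_self, Gam_eq, mul_assoc]
    · exact xGen_mul_Gam_of_ne s hji
  · change _ * _ = _ * _
    rw [coeff_cPoly]
    conv_lhs => rw [← alt j]
    rw [mul_sub, sub_mul, dGen_mul_coeffHom_shift, Finset.mul_sum, Finset.sum_mul]
    congr 1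
    refine Finset.sum_congr rfl fun i _ => ?_
    rw [← mul_assoc, dGen_mul_coeffHom_shift, mul_assoc, mul_assoc]
    congr 1
    split_ifs with hji
    · subst hji
      rw [← xGen_mul_dGen_self, Gam_eq, mul_assoc]
    · exact Gam_mul_dGen_of_ne s hji

end Central

/-! ### Independence of joint eigenvectors -/

section Eigen

/-- A sum of joint eigenvectors with nonzero integral joint eigenvalues, if annihilated by all
the operators, vanishes. -/
theorem eq_zero_of_eq_sum_eigenvectors {K M ι : Type*} [Field K] [CharZero K] [AddCommGroup M]
    [Module K M] (T : ι → M →ₗ[K] M) (Λ : Finset (ι → ℤ)) (h0 : (0 : ι → ℤ) ∉ Λ)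
    (b : (ι → ℤ) → M) (hb : ∀ μ ∈ Λ, ∀ i, T i (b μ) = (μ i : K) • b μ) {a : M}
    (ha : ∀ i, T i a = 0) (hab : a = ∑ μ ∈ Λ, b μ) : a = 0 := by
  classical
  induction Λ using Finset.induction_on generalizing b with
  | empty => simpa using hab
  | insert l Λ hl ih =>
    obtain ⟨i, hi⟩ : ∃ i, l i ≠ 0 := by
      by_contra! h
      exact h0 (by rw [show (0 : ι → ℤ) = l from (funext h).symm]; exact Finset.mem_insert_self _ _)
    have hi' : (l i : K) ≠ 0 := by exact_mod_cast hi
    -- Since `T i a = 0`, applying `1 - (l i)⁻¹ T i` fixes `a`, removes the eigenvector for `l`, and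
    -- rescales the others.
    refine ih (fun h => h0 (Finset.mem_insert_of_mem h))
      (fun μ => ((l i : K)⁻¹ * (l i - μ i)) • b μ) (fun μ hμ j => ?_) ?_
    · rw [map_smul, hb μ (Finset.mem_insert_of_mem hμ), smul_comm]
    · rw [Finset.sum_insert hl] at hab
      have e := congrArg (T i) hab
      rw [ha, map_add, hb l (Finset.mem_insert_self _ _), map_sum,
        Finset.sum_congr rfl fun μ hμ => hb μ (Finset.mem_insert_of_mem hμ) i] at e
      have e2 : (l i : K) • a = ∑ μ ∈ Λ, ((l i : K) - μ i) • b μ := by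
        simp only [sub_smul, Finset.sum_sub_distrib, ← Finset.smul_sum]
        rw [hab, smul_add, eq_sub_iff_add_eq, add_right_comm, add_eq_right]
        exact e.symm
      simp only [mul_smul, ← Finset.smul_sum]
      rw [← e2, smul_smul, inv_mul_cancel₀ hi', one_smul]

end Eigen

/-! ### Polynomials in the `c_k` over `Ū(n)` -/

section Coefficients

variable {K : Type*} [Field K] {n : ℕ}

/-- The ring of polynomials in `n` variables over `Ū(n)`. -/
abbrev PolyU (K : Type*) [Field K] (n : ℕ) : Type _ := MvPolynomial (Fin n) (Ubar K n)

variable (K) in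
/-- The translation `f ↦ f[-εⱼ]` applied to the coefficients of a polynomial. -/
noncomputable def shiftPoly (j : Fin n) : PolyU K n ≃ₐ[K] PolyU K n :=
  MvPolynomial.mapAlgEquiv (Fin n) (shiftEquiv K j)

@[simp] theorem shiftPoly_C (j : Fin n) (f : Ubar K n) :
    shiftPoly K j (MvPolynomial.C f) = MvPolynomial.C (shift K j f) := by
  simp [shiftPoly]

@[simp] theorem shiftPoly_X (j k : Fin n) :
    shiftPoly K j (MvPolynomial.X k : PolyU K n) = MvPolynomial.X k := by
  simp [shiftPoly]

theorem coeff_shiftPoly (j : Fin n) (P : PolyU K n) (m : Fin n →₀ ℕ) :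
    (shiftPoly K j P).coeff m = shift K j (P.coeff m) := by
  simp [shiftPoly, MvPolynomial.coeff_map]

/-- The polynomials invariant under all translations have constant coefficients. -/
theorem exists_map_of_shiftPoly_eq [CharZero K] {P : PolyU K n} (hP : ∀ j, shiftPoly K j P = P) :
    ∃ p : MvPolynomial (Fin n) K, MvPolynomial.map (algebraMap K (Ubar K n)) p = P := by
  have : ∀ m, P.coeff m ∈ Set.range (algebraMap K (Ubar K n)) := fun m =>
    exists_algebraMap_of_shift_eq fun j => by rw [← coeff_shiftPoly, hP]
  rw [← Set.mem_range, MvPolynomial.mem_range_map_iff_coeffs_subset]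
  intro a ha
  obtain ⟨m, -, rfl⟩ := MvPolynomial.mem_coeffs_iff.mp ha
  exact this m

variable {s : Fin n → Ubar K n} {ρ : (Ubar K n)[X]}

/-- The coefficientwise form of the difference equations for `ρ`. -/
def IsAdmissible (s : Fin n → Ubar K n) (ρ : (Ubar K n)[X]) : Prop :=
  ∀ j (k : ℕ), ρ.coeff k - shift K j (ρ.coeff k) = (eDiv K j).coeff k * s j

theorem IsRho.isAdmissible {σ : Ubar K n} (hρ : IsRho σ ρ) :
    IsAdmissible (fun j => delta j σ) ρ := by
  intro j k
  have := congrArg (fun p : (Ubar K n)[X] => p.coeff k) (hρ.difference j)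
  simpa only [coeff_sub, coeff_mul_C, coeff_map, RingHom.coe_coe] using this

/-- The homomorphism `t_k ↦ c_k` into the center. -/
noncomputable def centerHom (hρ : IsAdmissible s ρ) :
    MvPolynomial (Fin n) K →ₐ[K] Subalgebra.center K (Diff s) :=
  MvPolynomial.aeval fun k => ⟨(cPoly s ρ).coeff k, coeff_cPoly_mem_center s hρ k⟩

theorem centerHom_X (hρ : IsAdmissible s ρ) (k : Fin n) :
    (centerHom hρ (MvPolynomial.X k) : Diff s) = (cPoly s ρ).coeff k := by
  simp [centerHom]

theorem commute_centerHom (hρ : IsAdmissible s ρ) (f : Ubar K n) (p : MvPolynomial (Fin n) K) :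
    Commute (coeffHom s f) ((Subalgebra.center K (Diff s)).val.comp (centerHom hρ) p) :=
  Subalgebra.mem_center_iff.mp (centerHom hρ p).2 (coeffHom s f)

/-- Substitution of `c₁, …, cₙ` into polynomials with coefficients in `Ū(n)`. -/
noncomputable def subst (hρ : IsAdmissible s ρ) : PolyU K n →ₐ[K] Diff s :=
  -- The target is noncommutative, so substitution is built on `Ū(n) ⊗ K[t₁, …, tₙ]` from two
  -- homomorphisms with commuting images.
  (Algebra.TensorProduct.lift (coeffHom s) ((Subalgebra.center K (Diff s)).val.comp (centerHom hρ))
    (commute_centerHom hρ)).comp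
      ((MvPolynomial.algebraTensorAlgEquiv K (Ubar K n)).symm.toAlgHom.restrictScalars K)

theorem subst_C (hρ : IsAdmissible s ρ) (f : Ubar K n) :
    subst hρ (MvPolynomial.C f) = coeffHom s f := by
  have : (MvPolynomial.algebraTensorAlgEquiv K (Ubar K n)).symm
      (MvPolynomial.C f : PolyU K n) = f ⊗ₜ 1 :=
    (MvPolynomial.algebraTensorAlgEquiv K (Ubar K n)).symm.commutes f
  refine (congrArg _ this).trans ((Algebra.TensorProduct.lift_tmul _ _ (commute_centerHom hρ) _ _).trans ?_)
  rw [map_one, mul_one]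

theorem subst_map (hρ : IsAdmissible s ρ) (p : MvPolynomial (Fin n) K) :
    subst hρ (MvPolynomial.map (algebraMap K (Ubar K n)) p) = centerHom hρ p := by
  have : (MvPolynomial.algebraTensorAlgEquiv K (Ubar K n)).symm
      (MvPolynomial.map (algebraMap K (Ubar K n)) p) = 1 ⊗ₜ p :=
    MvPolynomial.algebraTensorAlgEquiv_symm_map K (Ubar K n) p
  refine (congrArg _ this).trans ((Algebra.TensorProduct.lift_tmul _ _ (commute_centerHom hρ) _ _).trans ?_)
  rw [map_one, one_mul]
  rfl

theorem subst_X (hρ : IsAdmissible s ρ) (k : Fin n) :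
    subst hρ (MvPolynomial.X k) = (cPoly s ρ).coeff k := by
  rw [← centerHom_X hρ, ← subst_map, MvPolynomial.map_X]

theorem commute_subst_X (hρ : IsAdmissible s ρ) (k : Fin n) (a : Diff s) :
    a * subst hρ (MvPolynomial.X k) = subst hρ (MvPolynomial.X k) * a := by
  rw [subst_X]
  exact Subalgebra.mem_center_iff.mp (coeff_cPoly_mem_center s hρ k) a

theorem xGen_mul_subst (hρ : IsAdmissible s ρ) (j : Fin n) (P : PolyU K n) :
    xGen s j * subst hρ P = subst hρ (shiftPoly K j P) * xGen s j := by
  induction P using MvPolynomial.induction_on with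
  | C f => rw [shiftPoly_C, subst_C, subst_C, xGen_mul_coeffHom]
  | add p q hp hq => simp only [map_add, mul_add, add_mul, hp, hq]
  | mul_X p i hp =>
    rw [map_mul, map_mul, map_mul, ← mul_assoc, hp, mul_assoc, commute_subst_X, shiftPoly_X,
      mul_assoc]

theorem dGen_mul_subst_shiftPoly (hρ : IsAdmissible s ρ) (j : Fin n) (P : PolyU K n) :
    dGen s j * subst hρ (shiftPoly K j P) = subst hρ P * dGen s j := by
  induction P using MvPolynomial.induction_on with
  | C f => rw [shiftPoly_C, subst_C, subst_C, dGen_mul_coeffHom_shift]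
  | add p q hp hq => simp only [map_add, mul_add, add_mul, hp, hq]
  | mul_X p i hp =>
    rw [map_mul, map_mul, map_mul, ← mul_assoc, hp, mul_assoc, mul_assoc, shiftPoly_X,
      commute_subst_X]

theorem coeffHom_mem_range (hρ : IsAdmissible s ρ) (f : Ubar K n) :
    coeffHom s f ∈ (subst hρ).range := ⟨_, subst_C hρ f⟩

/-- The inverse of the coefficient matrix solves the equations defining `c_k` for the `Γᵢ`. -/
theorem Gam_mem_range (hρ : IsAdmissible s ρ) (i : Fin n) : Gam s i ∈ (subst hρ).range := by
  have e : Gam s i = ∑ k : Fin n, coeffHom s (eInv K n i k) *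
      ((cPoly s ρ).coeff k + coeffHom s (ρ.coeff k)) := by
    simp only [coeff_cPoly, sub_add_cancel, Finset.mul_sum]
    rw [Finset.sum_comm]
    have : ∀ j, ∑ k : Fin n, coeffHom s (eInv K n i k) *
        (coeffHom s ((eDiv K j).coeff k) * Gam s j) =
          coeffHom s ((eInv K n * eMatrix K n) i j) * Gam s j := by
      intro j
      rw [Matrix.mul_apply, map_sum, Finset.sum_mul]
      refine Finset.sum_congr rfl fun k _ => ?_
      rw [map_mul, mul_assoc]
      rfl
    rw [Finset.sum_congr rfl fun j _ => this j, eInv_mul_eMatrix]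
    simp [Matrix.one_apply]
  rw [e]
  refine Subalgebra.sum_mem _ fun k _ => Subalgebra.mul_mem _ (coeffHom_mem_range hρ _)
    (Subalgebra.add_mem _ ⟨_, subst_X hρ k⟩ (coeffHom_mem_range hρ _))

end Coefficients

/-! ### Weights and the centralizer of the `h̃ᵢ` -/

section Words

variable {K : Type*} [Field K] {n : ℕ} {s : Fin n → Ubar K n} {ρ : (Ubar K n)[X]}

variable (s) in
/-- The generators `xⁱ` and `∂̄ᵢ` as one family. -/
def letter (y : Fin n × Bool) : Diff s := if y.2 then xGen s y.1 else dGen s y.1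

variable (s) in
/-- The product of a list of generators. -/
def word (l : List (Fin n × Bool)) : Diff s := (l.map (letter s)).prod

/-- The generator of opposite weight. -/
def opp (y : Fin n × Bool) : Fin n × Bool := (y.1, !y.2)

theorem opp_opp (y : Fin n × Bool) : opp (opp y) = y := by simp [opp]

theorem opp_ne (y : Fin n × Bool) : opp y ≠ y := by
  obtain ⟨i, b⟩ := y
  cases b <;> simp [opp]

theorem word_cons (y : Fin n × Bool) (l : List (Fin n × Bool)) :
    word s (y :: l) = letter s y * word s l := by simp [word]

theorem exists_letter_mul_subst (hρ : IsAdmissible s ρ) (y : Fin n × Bool) (P : PolyU K n) :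
    ∃ Q, letter s y * subst hρ P = subst hρ Q * letter s y := by
  obtain ⟨i, _ | _⟩ := y
  · obtain ⟨Q, rfl⟩ := (shiftPoly K i).surjective P
    exact ⟨Q, dGen_mul_subst_shiftPoly hρ i Q⟩
  · exact ⟨_, xGen_mul_subst hρ i P⟩

theorem exists_letter_mul_coeffHom (y : Fin n × Bool) (f : Ubar K n) :
    ∃ g, letter s y * coeffHom s f = coeffHom s g * letter s y := by
  obtain ⟨i, _ | _⟩ := y
  · obtain ⟨g, rfl⟩ := shift_surjective i f
    exact ⟨g, dGen_mul_coeffHom_shift s i g⟩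
  · exact ⟨_, xGen_mul_coeffHom s i f⟩

theorem exists_letter_mul_letter {y z : Fin n × Bool} (hyz : y.1 ≠ z.1) : ∃ f,
    letter s y * letter s z = coeffHom s f * (letter s z * letter s y) := by
  obtain ⟨i, _ | _⟩ := y <;> obtain ⟨j, _ | _⟩ := z
  · exact exists_dGen_mul_dGen s hyz
  · exact exists_dGen_mul_xGen s hyz
  · exact (exists_xGen_mul_dGen s hyz).imp fun _ => And.right
  · exact exists_xGen_mul_xGen s hyz

theorem letter_mul_opp_mem_range (hρ : IsAdmissible s ρ) (y : Fin n × Bool) :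
    letter s y * letter s (opp y) ∈ (subst hρ).range := by
  obtain ⟨i, _ | _⟩ := y
  · exact Gam_mem_range hρ i
  · change xGen s i * dGen s i ∈ _
    rw [xGen_mul_dGen_self]
    exact Subalgebra.sub_mem _ (Subalgebra.sum_mem _ fun j _ =>
      Subalgebra.mul_mem _ (coeffHom_mem_range hρ _) (Gam_mem_range hρ j)) (coeffHom_mem_range hρ _)

/-- The letter travels right to the first opposite letter, crossing letters of other indices up to
scalars. The pair it then forms is a polynomial in the `c_k` over `Ū(n)`, which can be carried back
to the left. -/
theorem exists_letter_mul_word (hρ : IsAdmissible s ρ) (y : Fin n × Bool)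
    (v : List (Fin n × Bool)) (hv : opp y ∈ v) :
    ∃ P, letter s y * word s v = subst hρ P * word s (v.erase (opp y)) := by
  induction v with
  | nil => simp at hv
  | cons z v ih =>
    by_cases hz : z = opp y
    · subst hz
      obtain ⟨P, hP⟩ := letter_mul_opp_mem_range hρ y
      refine ⟨P, ?_⟩
      rw [word_cons, ← mul_assoc, List.erase_cons_head]
      exact congrArg (· * word s v) hP.symm
    · have hmem : opp y ∈ v := by
        rcases List.mem_cons.mp hv with h | h
        · exact absurd h.symm hz
        · exact h
      obtain ⟨P, hP⟩ := ih hmem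
      obtain ⟨Q, hQ⟩ := exists_letter_mul_subst hρ z P
      rw [List.erase_cons_tail (by simpa using hz), word_cons, word_cons]
      by_cases hzy : y.1 = z.1
      -- A letter of the same index that is not opposite is the same letter; it stays in front, and
      -- the inner copy does the cancelling.
      · have hzy' : z = y := by
          obtain ⟨i, b⟩ := y
          obtain ⟨j, c⟩ := z
          obtain rfl : i = j := hzy
          cases b <;> cases c <;> simp_all [opp]
        rw [hzy'] at hQ ⊢
        exact ⟨Q, by rw [hP, ← mul_assoc, hQ, mul_assoc]⟩
      · obtain ⟨f, hf⟩ := exists_letter_mul_letter (s := s) hzy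
        refine ⟨MvPolynomial.C f * Q, ?_⟩
        rw [← mul_assoc, hf, mul_assoc, mul_assoc, hP, ← mul_assoc (letter s z), hQ, map_mul,
          subst_C]
        simp only [mul_assoc]

/-- Words of weight zero are polynomials in `c₁, …, cₙ` with coefficients in `Ū(n)`. -/
theorem word_mem_range (hρ : IsAdmissible s ρ) (l : List (Fin n × Bool))
    (hl : ∀ z, l.count z = l.count (opp z)) : word s l ∈ (subst hρ).range := by
  induction hN : l.length using Nat.strong_induction_on generalizing l with
  | _ N ih =>
    cases l with
    | nil => exact Subalgebra.one_mem _
    | cons y v =>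
      have hmem : opp y ∈ v := by
        have := hl y
        rw [List.count_cons_self, List.count_cons_of_ne (opp_ne y).symm] at this
        exact List.count_pos_iff.mp (by omega)
      obtain ⟨P, hP⟩ := exists_letter_mul_word hρ y v hmem
      rw [word_cons, hP]
      refine Subalgebra.mul_mem _ ⟨P, rfl⟩ (ih (v.erase (opp y)).length ?_ _ (fun z => ?_) rfl)
      · rw [List.length_erase_of_mem hmem, ← hN, List.length_cons]
        omega
      · have h1 := hl z
        have hpos := List.count_pos_iff.mpr hmem
        by_cases hz : z = y
        · subst hz
          rw [List.count_erase_self, List.count_erase_of_ne (opp_ne z).symm]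
          rw [List.count_cons_self, List.count_cons_of_ne (opp_ne z).symm] at h1
          omega
        · by_cases hz' : z = opp y
          · subst hz'
            rw [opp_opp, List.count_erase_self, List.count_erase_of_ne (opp_ne y).symm]
            rw [opp_opp, List.count_cons_self, List.count_cons_of_ne (opp_ne y).symm] at h1
            omega
          · have hz2 : opp z ≠ opp y := fun h => hz (by rw [← opp_opp z, h, opp_opp])
            have hz3 : opp z ≠ y := fun h => hz' (by rw [← opp_opp z, h])
            rwa [List.count_erase_of_ne hz', List.count_erase_of_ne hz2,
              ← List.count_cons_of_ne (Ne.symm hz), ← List.count_cons_of_ne (Ne.symm hz3)]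

variable (s) in
/-- The commutator with `h̃ᵢ`. -/
noncomputable def adH (i : Fin n) : Diff s →ₗ[K] Diff s :=
  LinearMap.mulLeft K (coeffHom s (h K i)) - LinearMap.mulRight K (coeffHom s (h K i))

theorem adH_apply (i : Fin n) (a : Diff s) :
    adH s i a = coeffHom s (h K i) * a - a * coeffHom s (h K i) := by simp [adH]

theorem adH_mul (i : Fin n) (a b : Diff s) :
    adH s i (a * b) = adH s i a * b + a * adH s i b := by
  simp only [adH_apply, sub_mul, mul_sub, mul_assoc, sub_add_sub_cancel]

theorem adH_coeffHom (i : Fin n) (f : Ubar K n) : adH s i (coeffHom s f) = 0 := by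
  rw [adH_apply, ← map_mul, ← map_mul, mul_comm, sub_self]

theorem adH_xGen (i j : Fin n) :
    adH s i (xGen s j) = ((if i = j then 1 else 0 : ℤ) : K) • xGen s j := by
  rw [adH_apply, xGen_mul_coeffHom, shift_h, map_sub, apply_ite_one]
  split_ifs <;> simp [sub_mul]

theorem adH_dGen (i j : Fin n) :
    adH s i (dGen s j) = ((if i = j then -1 else 0 : ℤ) : K) • dGen s j := by
  rw [adH_apply, ← dGen_mul_coeffHom_shift, shift_h, map_sub, apply_ite_one]
  split_ifs
  · rw [mul_sub, mul_one, Int.cast_neg, Int.cast_one, Algebra.smul_def, map_neg, map_one,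
      sub_sub_cancel_left]
    exact (neg_one_mul (dGen s j)).symm
  · simp

/-- The weight of a word. -/
def wt (l : List (Fin n × Bool)) (i : Fin n) : ℤ := (l.count (i, true) : ℤ) - l.count (i, false)

theorem adH_word (i : Fin n) (l : List (Fin n × Bool)) :
    adH s i (word s l) = (wt l i : K) • word s l := by
  induction l with
  | nil => simpa [word, wt] using adH_coeffHom (s := s) i 1
  | cons y l ih =>
    obtain ⟨c, hc, hw⟩ : ∃ c : ℤ, adH s i (letter s y) = (c : K) • letter s y ∧
        wt (y :: l) i = c + wt l i := by
      obtain ⟨j, _ | _⟩ := y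
      · refine ⟨_, adH_dGen i j, ?_⟩
        by_cases hij : i = j
        · subst hij
          simp [wt]
          ring
        · simp [wt, hij, Ne.symm hij]
      · refine ⟨_, adH_xGen i j, ?_⟩
        by_cases hij : i = j
        · subst hij
          simp [wt]
          ring
        · simp [wt, hij, Ne.symm hij]
    rw [word_cons, adH_mul, ih, hc, hw, smul_mul_assoc, mul_smul_comm, ← add_smul, Int.cast_add]

theorem adH_coeffHom_mul_word (i : Fin n) (f : Ubar K n) (l : List (Fin n × Bool)) :
    adH s i (coeffHom s f * word s l) = (wt l i : K) • (coeffHom s f * word s l) := by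
  rw [adH_mul, adH_coeffHom, adH_word, zero_mul, zero_add, mul_smul_comm]

/-- The span contains `1` and is stable under left multiplication by the generators, because scalars
can be moved to the left of any letter. -/
theorem span_words (a : Diff s) : a ∈ Submodule.span K
    (Set.range fun p : Ubar K n × List (Fin n × Bool) => coeffHom s p.1 * word s p.2) := by
  set V := Submodule.span K
    (Set.range fun p : Ubar K n × List (Fin n × Bool) => coeffHom s p.1 * word s p.2)
  have gen : ∀ a : Diff s, (∀ f l, a * (coeffHom s f * word s l) ∈ V) → ∀ b ∈ V, a * b ∈ V := by
    intro a ha b hb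
    have : V ≤ V.comap (LinearMap.mulLeft K a) := by
      refine Submodule.span_le.mpr ?_
      rintro _ ⟨⟨f, l⟩, rfl⟩
      exact ha f l
    exact this hb
  have hlet : ∀ y, ∀ b ∈ V, letter s y * b ∈ V := by
    intro y
    refine gen _ fun f l => ?_
    obtain ⟨g, hg⟩ := exists_letter_mul_coeffHom (s := s) y f
    rw [← mul_assoc, hg, mul_assoc, ← word_cons]
    exact Submodule.subset_span ⟨(g, y :: l), rfl⟩
  have key : ∀ b ∈ V, a * b ∈ V := by
    induction a using Diff.induction with
    | coeff f =>
      refine gen _ fun g l => ?_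
      rw [← mul_assoc, ← map_mul]
      exact Submodule.subset_span ⟨(f * g, l), rfl⟩
    | x i => exact hlet (i, true)
    | d i => exact hlet (i, false)
    | mul a b ha hb => intro c hc; rw [mul_assoc]; exact ha _ (hb _ hc)
    | add a b ha hb => intro c hc; rw [add_mul]; exact V.add_mem (ha _ hc) (hb _ hc)
  simpa using key 1 (Submodule.subset_span ⟨(1, []), by simp [word]⟩)

/-- The centralizer of `h̃₁, …, h̃ₙ`. -/
theorem mem_range_of_adH_eq_zero [CharZero K] (hρ : IsAdmissible s ρ) {a : Diff s}
    (ha : ∀ i, adH s i a = 0) : a ∈ (subst hρ).range := by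
  -- Spans of words of a given weight, not full eigenspaces: the weight zero part is then visibly
  -- generated by balanced words.
  let E : (Fin n → ℤ) → Submodule K (Diff s) := fun μ =>
    Submodule.span K {b | ∃ f l, wt l = μ ∧ b = coeffHom s f * word s l}
  have hE : ∀ μ, ∀ b ∈ E μ, ∀ i, adH s i b = (μ i : K) • b := by
    intro μ b hb i
    have : E μ ≤ LinearMap.ker (adH s i - (μ i : K) • LinearMap.id) := by
      refine Submodule.span_le.mpr ?_
      rintro _ ⟨f, l, rfl, rfl⟩
      simp [adH_coeffHom_mul_word]
    simpa [sub_eq_zero] using this hb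
  have hE0 : ∀ b ∈ E 0, b ∈ (subst hρ).range := by
    intro b hb
    have : E 0 ≤ Subalgebra.toSubmodule (subst hρ).range := by
      refine Submodule.span_le.mpr ?_
      rintro _ ⟨f, l, hl, rfl⟩
      refine Subalgebra.mul_mem _ (coeffHom_mem_range hρ f) (word_mem_range hρ l ?_)
      rintro ⟨i, _ | _⟩
      all_goals
        have := congrFun hl i
        simp only [wt, Pi.zero_apply] at this
        simp only [opp, Bool.not_false, Bool.not_true]
        omega
    exact this hb
  have htop : a ∈ ⨆ μ, E μ := by
    refine Submodule.span_le.mpr ?_ (span_words a)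
    rintro _ ⟨⟨f, l⟩, rfl⟩
    exact Submodule.mem_iSup_of_mem (wt l) (Submodule.subset_span ⟨f, l, rfl, rfl⟩)
  obtain ⟨b, hb, hsum⟩ := (Submodule.mem_iSup_iff_exists_finsupp _ _).mp htop
  have h0 := hE0 _ (hb 0)
  -- The difference is annihilated by every `adH s i`, yet is a sum of eigenvectors of nonzero
  -- weight.
  have hz : a - b 0 = 0 := by
    refine eq_zero_of_eq_sum_eigenvectors (adH s) (b.support.erase 0) (by simp) b
      (fun μ _ i => hE μ _ (hb μ) i) (fun i => ?_) ?_
    · rw [map_sub, ha, hE 0 _ (hb 0)]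
      simp
    · rw [← hsum, sub_eq_iff_eq_add, Finsupp.sum]
      by_cases h : (0 : Fin n → ℤ) ∈ b.support
      · rw [Finset.sum_erase_add _ _ h]
      · rw [Finset.erase_eq_of_notMem h, Finsupp.notMem_support_iff.mp h, add_zero]
  rw [sub_eq_zero.mp hz]
  exact h0

end Words

/-! ### A representation on `Ū(n)[t₁, …, tₙ]` -/

section Representation

variable {K : Type*} [Field K] {n : ℕ}

theorem algHom_sub_apply {A M : Type*} [Ring A] [Algebra K A] [AddCommGroup M] [Module K M]
    (f : A →ₐ[K] Module.End K M) (a b : A) (P : M) : f (a - b) P = f a P - f b P := by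
  rw [map_sub, LinearMap.sub_apply]

variable (K) in
/-- The factor `∏_{k > i} 1 / h̃ᵢₖ` by which `xⁱ` differs from a translation. -/
noncomputable def xCoeff (i : Fin n) : Ubar K n :=
  ∏ k ∈ Finset.univ.filter (i < ·), Ring.inverse (hh K i k)

theorem isUnit_xCoeff (i : Fin n) : IsUnit (xCoeff K i) :=
  Finset.prod_induction _ IsUnit (fun _ _ => IsUnit.mul) isUnit_one fun _ hk =>
    (isUnit_hh (Finset.mem_filter.mp hk).2.ne).ringInverse

theorem shift_xCoeff_of_lt {i j : Fin n} (hij : i < j) : shift K i (xCoeff K j) = xCoeff K j := by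
  rw [xCoeff, map_prod]
  refine Finset.prod_congr rfl fun k hk => ?_
  have hjk := (Finset.mem_filter.mp hk).2
  rw [map_ringInverse _ (isUnit_hh hjk.ne), shift_hh, if_neg hij.ne', if_neg (hij.trans hjk).ne',
    sub_zero, add_zero]

theorem shift_xCoeff_of_gt {i j : Fin n} (hij : i < j) :
    shift K j (xCoeff K i) * (hh K i j + 1) = xCoeff K i * hh K i j := by
  have hmem : j ∈ Finset.univ.filter (i < ·) := by simpa using hij
  have hrest : shift K j (∏ k ∈ (Finset.univ.filter (i < ·)).erase j, Ring.inverse (hh K i k)) =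
      ∏ k ∈ (Finset.univ.filter (i < ·)).erase j, Ring.inverse (hh K i k) := by
    rw [map_prod]
    refine Finset.prod_congr rfl fun k hk => ?_
    have hik := (Finset.mem_filter.mp (Finset.mem_of_mem_erase hk)).2
    rw [map_ringInverse _ (isUnit_hh hik.ne), shift_hh, if_neg hij.ne,
      if_neg (Finset.ne_of_mem_erase hk), sub_zero, add_zero]
  rw [xCoeff, ← Finset.mul_prod_erase _ _ hmem, map_mul, hrest,
    map_ringInverse _ (isUnit_hh hij.ne), shift_hh_right hij.ne]
  have h1 := Ring.inverse_mul_cancel _ (isUnit_hh_add_one (K := K) hij.ne)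
  have h2 := Ring.inverse_mul_cancel _ (isUnit_hh (K := K) hij.ne)
  set r := ∏ k ∈ (Finset.univ.filter (i < ·)).erase j, Ring.inverse (hh K i k)
  linear_combination r * h1 - r * h2

/-- Translations commute, so the relation between `xⁱ` and `xʲ` reduces to this cocycle condition.
Only `xCoeff K i`, for the smaller index, contains `h̃ᵢⱼ`. -/
theorem xCoeff_mul_shift {i j : Fin n} (hij : i < j) : xCoeff K i * shift K i (xCoeff K j) =
    (hh K i j + 1) * Ring.inverse (hh K i j) * (xCoeff K j * shift K j (xCoeff K i)) := by
  rw [shift_xCoeff_of_lt hij]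
  have h1 := shift_xCoeff_of_gt (K := K) hij
  have h2 := Ring.inverse_mul_cancel _ (isUnit_hh (K := K) hij.ne)
  linear_combination (-Ring.inverse (hh K i j) * xCoeff K j) * h1 - xCoeff K i * xCoeff K j * h2

theorem shift_gamFactor_mul {i j : Fin n} (hij : i ≠ j) :
    shift K i (gamFactor K j i) * gamFactor K i j = 1 := by
  rw [shift_gamFactor_right hij.symm, mul_comm, gamFactor_mul_swap hij]

theorem shift_comm (i j : Fin n) (f : Ubar K n) :
    shift K i (shift K j f) = shift K j (shift K i f) := by
  have : (shift K i).comp (shift K j) = (shift K j).comp (shift K i) := by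
    refine algHom_ext_h fun l => ?_
    simp only [AlgHom.comp_apply, shift_h, map_sub, apply_ite_one]
    ring
  exact DFunLike.congr_fun this f

theorem shiftPoly_comm (i j : Fin n) (P : PolyU K n) :
    shiftPoly K i (shiftPoly K j P) = shiftPoly K j (shiftPoly K i P) := by
  ext m
  simp only [coeff_shiftPoly]
  exact shift_comm i j _

/-- The action of `xⁱ` on polynomials over `Ū(n)`. -/
noncomputable def xRep (i : Fin n) : PolyU K n →ₗ[K] PolyU K n :=
  LinearMap.mulLeft K (MvPolynomial.C (xCoeff K i)) ∘ₗ (shiftPoly K i).toLinearMap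

theorem xRep_apply (i : Fin n) (P : PolyU K n) :
    xRep i P = MvPolynomial.C (xCoeff K i) * shiftPoly K i P := rfl

theorem xRep_mul (i : Fin n) (P Q : PolyU K n) :
    xRep i (P * Q) = shiftPoly K i P * xRep i Q := by
  simp only [xRep_apply, map_mul]
  ring

theorem xRep_C_mul (i : Fin n) (f : Ubar K n) (Q : PolyU K n) :
    xRep i (MvPolynomial.C f * Q) = MvPolynomial.C (shift K i f) * xRep i Q := by
  rw [xRep_mul, shiftPoly_C]

/-- The inverse of the action of `xⁱ`. -/
noncomputable def xRepInv (i : Fin n) : PolyU K n →ₗ[K] PolyU K n :=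
  (shiftPoly K i).symm.toLinearMap ∘ₗ
    LinearMap.mulLeft K (MvPolynomial.C (Ring.inverse (xCoeff K i)))

theorem xRepInv_apply (i : Fin n) (P : PolyU K n) : xRepInv i P =
    (shiftPoly K i).symm (MvPolynomial.C (Ring.inverse (xCoeff K i)) * P) := rfl

theorem xRepInv_xRep (i : Fin n) (P : PolyU K n) : xRepInv i (xRep i P) = P := by
  rw [xRepInv_apply, xRep_apply, ← mul_assoc, ← map_mul, Ring.inverse_mul_cancel _ (isUnit_xCoeff i), map_one, one_mul,
    AlgEquiv.symm_apply_apply]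

theorem xRep_xRepInv (i : Fin n) (P : PolyU K n) : xRep i (xRepInv i P) = P := by
  rw [xRepInv_apply, xRep_apply, AlgEquiv.apply_symm_apply, ← mul_assoc, ← map_mul,
    Ring.mul_inverse_cancel _ (isUnit_xCoeff i), map_one, one_mul]

theorem xRep_surjective (i : Fin n) : Function.Surjective (xRep (K := K) i) :=
  fun P => ⟨_, xRep_xRepInv i P⟩

theorem xRep_xRep_of_lt {i j : Fin n} (hij : i < j) (Q : PolyU K n) : xRep i (xRep j Q) =
    MvPolynomial.C ((hh K i j + 1) * Ring.inverse (hh K i j)) * xRep j (xRep i Q) := by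
  rw [xRep_apply j, xRep_apply i Q, xRep_C_mul, xRep_C_mul, xRep_apply, xRep_apply,
    shiftPoly_comm j i]
  have e := congrArg (MvPolynomial.C (σ := Fin n)) (xCoeff_mul_shift (K := K) hij)
  simp only [map_mul] at e ⊢
  linear_combination shiftPoly K i (shiftPoly K j Q) * e

theorem xRep_xRep_of_gt {i j : Fin n} (hij : j < i) (Q : PolyU K n) : xRep i (xRep j Q) =
    MvPolynomial.C (gamFactor K i j) * xRep j (xRep i Q) := by
  rw [xRep_xRep_of_lt hij, ← mul_assoc, ← map_mul, gamFactor_mul_swap hij.ne', map_one, one_mul]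

variable (s : Fin n → Ubar K n) (ρ : (Ubar K n)[X])

/-- The polynomial by which `Γᵢ` acts. -/
noncomputable def gamPoly (i : Fin n) : PolyU K n :=
  ∑ k : Fin n, MvPolynomial.C (eInv K n i k) * (MvPolynomial.X k + MvPolynomial.C (ρ.coeff k))

theorem sum_eDiv_mul_gamPoly (k : Fin n) :
    ∑ i, MvPolynomial.C ((eDiv K i).coeff k) * gamPoly ρ i =
      MvPolynomial.X k + MvPolynomial.C (ρ.coeff k) := by
  simp only [gamPoly, Finset.mul_sum]
  rw [Finset.sum_comm]
  have : ∀ l : Fin n, ∑ i, MvPolynomial.C ((eDiv K i).coeff k) * (MvPolynomial.C (eInv K n i l) *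
      (MvPolynomial.X l + MvPolynomial.C (ρ.coeff l))) =
        MvPolynomial.C ((eMatrix K n * eInv K n) k l) *
          (MvPolynomial.X l + MvPolynomial.C (ρ.coeff l) : PolyU K n) := by
    intro l
    rw [Matrix.mul_apply, map_sum, Finset.sum_mul]
    refine Finset.sum_congr rfl fun i _ => ?_
    rw [map_mul, mul_assoc]
    rfl
  rw [Finset.sum_congr rfl fun l _ => this l, eMatrix_mul_eInv]
  simp [Matrix.one_apply]

/-- A translation is a ring homomorphism, so the translated coefficient matrix is still invertible.
-/
theorem eq_of_sum_shift_eDiv_mul_eq (j : Fin n) {A B : Fin n → PolyU K n}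
    (h : ∀ k : Fin n, ∑ i, MvPolynomial.C (shift K j ((eDiv K i).coeff k)) * A i =
      ∑ i, MvPolynomial.C (shift K j ((eDiv K i).coeff k)) * B i) (l : Fin n) : A l = B l := by
  have key : ∀ A : Fin n → PolyU K n, ∑ k : Fin n, MvPolynomial.C (shift K j (eInv K n l k)) *
      ∑ i, MvPolynomial.C (shift K j ((eDiv K i).coeff k)) * A i = A l := by
    intro A
    simp only [Finset.mul_sum]
    rw [Finset.sum_comm]
    have : ∀ i, ∑ k : Fin n, MvPolynomial.C (shift K j (eInv K n l k)) *
        (MvPolynomial.C (shift K j ((eDiv K i).coeff k)) * A i) =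
          MvPolynomial.C (shift K j ((eInv K n * eMatrix K n) l i)) * A i := by
      intro i
      rw [Matrix.mul_apply, map_sum, map_sum, Finset.sum_mul]
      refine Finset.sum_congr rfl fun k _ => ?_
      rw [map_mul, map_mul, mul_assoc]
      rfl
    rw [Finset.sum_congr rfl fun i _ => this i, eInv_mul_eMatrix]
    simp [Matrix.one_apply, apply_ite (shift K j), apply_ite (MvPolynomial.C (σ := Fin n))]
  rw [← key A, ← key B]
  exact Finset.sum_congr rfl fun k _ => by rw [h k]

variable {s ρ}

/-- Summed against the translated coefficients of `e(t) / (1 + h̃ᵢ t)`, both families give `t_k`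
plus the translate of `ρ_k`: the left because translation fixes `t_k`, the right by
`sum_shift_eDiv_mul`. -/
theorem shiftPoly_gamPoly (hρ : IsAdmissible s ρ) (j l : Fin n) :
    shiftPoly K j (gamPoly ρ l) =
      if j = l then ∑ i, MvPolynomial.C (Ring.inverse (1 - hh K j i)) * gamPoly ρ i -
        MvPolynomial.C (s j) else MvPolynomial.C (gamFactor K j l) * gamPoly ρ l := by
  refine eq_of_sum_shift_eDiv_mul_eq j (A := fun l => shiftPoly K j (gamPoly ρ l))
    (B := fun l => if j = l then ∑ i, MvPolynomial.C (Ring.inverse (1 - hh K j i)) * gamPoly ρ i -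
        MvPolynomial.C (s j) else MvPolynomial.C (gamFactor K j l) * gamPoly ρ l) (fun k => ?_) l
  have h1 := sum_shift_eDiv_mul (IsScalarTower.toAlgHom K (Ubar K n) (PolyU K n)) (gamPoly ρ) j k
    (hρ j k)
  simp only [IsScalarTower.coe_toAlgHom', MvPolynomial.algebraMap_eq] at h1
  rw [sum_eDiv_mul_gamPoly] at h1
  refine Eq.trans ?_ (sub_eq_iff_eq_add.mp (h1.trans (add_sub_cancel_right (G := PolyU K n) _ _))).symm
  have h2 := congrArg (shiftPoly K j) (sum_eDiv_mul_gamPoly ρ k)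
  simpa only [map_sum, map_mul, map_add, shiftPoly_C, shiftPoly_X] using h2

theorem shiftPoly_gamPoly_of_ne (hρ : IsAdmissible s ρ) {j l : Fin n} (hjl : j ≠ l) :
    shiftPoly K j (gamPoly ρ l) = MvPolynomial.C (gamFactor K j l) * gamPoly ρ l := by
  rw [shiftPoly_gamPoly hρ, if_neg hjl]

variable (ρ) in
/-- The action of `∂̄ᵢ` on polynomials over `Ū(n)`. -/
noncomputable def dRep (i : Fin n) : PolyU K n →ₗ[K] PolyU K n :=
  LinearMap.mulLeft K (gamPoly ρ i) ∘ₗ xRepInv i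

theorem dRep_xRep (i : Fin n) (Q : PolyU K n) : dRep ρ i (xRep i Q) = gamPoly ρ i * Q := by
  change gamPoly ρ i * xRepInv i (xRep i Q) = _
  rw [xRepInv_xRep]

theorem dRep_shiftPoly_mul (i : Fin n) (P Q : PolyU K n) :
    dRep ρ i (shiftPoly K i P * Q) = P * dRep ρ i Q := by
  obtain ⟨Q, rfl⟩ := xRep_surjective i Q
  rw [← xRep_mul, dRep_xRep, dRep_xRep]
  ring

theorem dRep_C_shift_mul (i : Fin n) (f : Ubar K n) (Q : PolyU K n) :
    dRep ρ i (MvPolynomial.C (shift K i f) * Q) = MvPolynomial.C f * dRep ρ i Q := by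
  rw [← shiftPoly_C, dRep_shiftPoly_mul]

theorem xRep_dRep_xRep_of_ne (hρ : IsAdmissible s ρ) {i j : Fin n} (hij : i ≠ j)
    (Q : PolyU K n) : xRep i (dRep ρ j (xRep j Q)) =
      MvPolynomial.C (gamFactor K i j) * gamPoly ρ j * xRep i Q := by
  rw [dRep_xRep, xRep_mul, shiftPoly_gamPoly_of_ne hρ hij]

theorem dRep_dRep_xRep_xRep (hρ : IsAdmissible s ρ) {i j : Fin n} (hij : i ≠ j)
    (Q : PolyU K n) : dRep ρ i (dRep ρ j (xRep j (xRep i Q))) =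
      MvPolynomial.C (gamFactor K j i) * (gamPoly ρ i * gamPoly ρ j) * Q := by
  have e : gamPoly ρ j =
      shiftPoly K i (MvPolynomial.C (gamFactor K j i) * gamPoly ρ j) := by
    rw [map_mul, shiftPoly_C, shiftPoly_gamPoly_of_ne hρ hij, ← mul_assoc, ← map_mul,
      shift_gamFactor_mul hij, map_one, one_mul]
  rw [dRep_xRep]
  conv_lhs => rw [e]
  rw [dRep_shiftPoly_mul, dRep_xRep]
  ring

variable (ρ) in
/-- The action of the generators on polynomials over `Ū(n)`. -/
noncomputable def genRep : Gen K n → Module.End K (PolyU K n)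
  | .coeff f => LinearMap.mulLeft K (MvPolynomial.C f)
  | .x i => xRep i
  | .d i => dRep ρ i

theorem lift_genRep_fc (f : Ubar K n) (P : PolyU K n) :
    FreeAlgebra.lift K (genRep ρ) (fc f) P = MvPolynomial.C f * P := by
  rw [fc, FreeAlgebra.lift_ι_apply]
  rfl

theorem lift_genRep_fx (i : Fin n) : FreeAlgebra.lift K (genRep ρ) (fx K i) = xRep i := by
  rw [fx, FreeAlgebra.lift_ι_apply]
  rfl

theorem lift_genRep_fd (i : Fin n) : FreeAlgebra.lift K (genRep ρ) (fd K i) = dRep ρ i := by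
  rw [fd, FreeAlgebra.lift_ι_apply]
  rfl

theorem shift_h_add (i j : Fin n) :
    shift K j (h K i + if i = j then 1 else 0) = h K i := by
  rw [map_add, shift_h, apply_ite_one, sub_add_cancel]

theorem lift_genRep_rel (hρ : IsAdmissible s ρ) ⦃a b : Free K n⦄ (hab : Rel s a b) :
    FreeAlgebra.lift K (genRep ρ) a = FreeAlgebra.lift K (genRep ρ) b := by
  refine LinearMap.ext fun P => ?_
  cases hab with
  | coeff_algebraMap c =>
    rw [lift_genRep_fc, AlgHom.commutes, Module.algebraMap_end_apply, Algebra.smul_def]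
    rfl
  | coeff_add f g =>
    rw [map_add, LinearMap.add_apply, lift_genRep_fc, lift_genRep_fc, lift_genRep_fc, map_add,
      add_mul]
  | coeff_mul f g =>
    rw [map_mul, Module.End.mul_apply, lift_genRep_fc, lift_genRep_fc, lift_genRep_fc, map_mul,
      mul_assoc]
  | weight_x i j =>
    simp only [map_mul, Module.End.mul_apply, lift_genRep_fc, lift_genRep_fx]
    rw [xRep_C_mul, shift_h_add]
  | weight_d i j =>
    simp only [map_mul, Module.End.mul_apply, lift_genRep_fc, lift_genRep_fd]
    rw [← shift_h, dRep_C_shift_mul]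
  | x_x i j hij =>
    simp only [map_mul, Module.End.mul_apply, lift_genRep_fc, lift_genRep_fx]
    rw [xRep_xRep_of_lt hij, map_mul]
  | d_d i j hij =>
    simp only [map_mul (FreeAlgebra.lift K (genRep ρ)), Module.End.mul_apply, lift_genRep_fc,
      lift_genRep_fd]
    -- Every vector has the form `xⁱ xʲ Q`; on such vectors each `∂̄` meets an `x`, and the relation
    -- becomes an equality of multiplications.
    obtain ⟨P, rfl⟩ := xRep_surjective i P
    obtain ⟨Q, rfl⟩ := xRep_surjective j P
    rw [dRep_dRep_xRep_xRep hρ hij.ne', xRep_xRep_of_lt hij]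
    -- The scalar depends only on `h̃ᵢⱼ`, which the two translations together leave fixed, so it
    -- passes through `xʲ xⁱ` unchanged.
    have hp : (hh K i j + 1) * Ring.inverse (hh K i j) =
        shift K j (shift K i ((hh K i j + 1) * Ring.inverse (hh K i j))) := by
      simp only [map_mul, map_add, map_one, map_ringInverse _ (isUnit_hh (K := K) hij.ne),
        map_ringInverse _ (isUnit_hh_sub_one (K := K) hij.ne),
        shift_hh_left hij.ne, map_sub, shift_hh_right hij.ne, add_sub_cancel_right, sub_add_cancel]
    have h1 := congrArg (MvPolynomial.C (σ := Fin n)) (gamFactor_mul_swap (K := K) hij.ne')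
    have h2 : (hh K i j - 1) * Ring.inverse (hh K i j) * gamFactor K i j = 1 := by
      have h3 := Ring.inverse_mul_cancel _ (isUnit_hh (K := K) hij.ne)
      have h4 := gamFactor_mul (K := K) hij.ne
      linear_combination Ring.inverse (hh K i j) * h4 + h3
    have h2' := congrArg (MvPolynomial.C (σ := Fin n)) h2
    rw [hp, ← xRep_C_mul j, ← xRep_C_mul i, dRep_dRep_xRep_xRep hρ hij.ne]
    rw [map_mul, map_one] at h1 h2'
    linear_combination gamPoly ρ i * gamPoly ρ j * Q * (h1 - h2')
  | x_d_lt i j hij =>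
    simp only [map_mul, Module.End.mul_apply, lift_genRep_fx, lift_genRep_fd]
    obtain ⟨Q, rfl⟩ := xRep_surjective j P
    rw [xRep_dRep_xRep_of_ne hρ hij.ne, xRep_xRep_of_lt hij, ← shift_gamFactor_right hij.ne,
      dRep_C_shift_mul, dRep_xRep, mul_assoc]
  | x_d_gt i j hij =>
    simp only [map_mul (FreeAlgebra.lift K (genRep ρ)), Module.End.mul_apply, lift_genRep_fc,
      lift_genRep_fx, lift_genRep_fd]
    obtain ⟨Q, rfl⟩ := xRep_surjective j P
    obtain ⟨f, hf, e⟩ := exists_shift_eq_gamFactor (K := K) hij.ne'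
    rw [xRep_dRep_xRep_of_ne hρ hij.ne', xRep_xRep_of_gt hij, ← e]
    conv_rhs => rw [e, ← hf]
    rw [dRep_C_shift_mul, dRep_xRep, map_mul MvPolynomial.C _ f]
    ring
  | x_d_same i =>
    obtain ⟨Q, rfl⟩ := xRep_surjective i P
    refine Eq.trans ?_ (algHom_sub_apply (M := PolyU K n) _ _ _ _).symm
    simp only [map_mul, map_sum, Module.End.mul_apply,
      LinearMap.sum_apply, lift_genRep_fc, lift_genRep_fx, lift_genRep_fd, dRep_xRep]
    rw [xRep_mul, shiftPoly_gamPoly hρ, if_pos rfl]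
    refine (sub_mul (α := PolyU K n) _ _ _).trans ?_
    rw [Finset.sum_mul]
    simp only [mul_assoc]

/-- The representation of `Diff_h(σ₁, …, σₙ)` on polynomials over `Ū(n)`. -/
noncomputable def rep (hρ : IsAdmissible s ρ) : Diff s →ₐ[K] Module.End K (PolyU K n) :=
  RingQuot.liftAlgHom K ⟨FreeAlgebra.lift K (genRep ρ), lift_genRep_rel hρ⟩

theorem rep_coeffHom (hρ : IsAdmissible s ρ) (f : Ubar K n) (P : PolyU K n) :
    rep hρ (coeffHom s f) P = MvPolynomial.C f * P := by
  rw [← mk_fc, rep, RingQuot.liftAlgHom_mkAlgHom_apply, lift_genRep_fc]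

theorem rep_xGen (hρ : IsAdmissible s ρ) (i : Fin n) : rep hρ (xGen s i) = xRep i := by
  rw [← mk_fx, rep, RingQuot.liftAlgHom_mkAlgHom_apply, lift_genRep_fx]

theorem rep_dGen (hρ : IsAdmissible s ρ) (i : Fin n) : rep hρ (dGen s i) = dRep ρ i := by
  rw [← mk_fd, rep, RingQuot.liftAlgHom_mkAlgHom_apply, lift_genRep_fd]

theorem rep_subst (hρ : IsAdmissible s ρ) (P Q : PolyU K n) :
    rep hρ (subst hρ P) Q = P * Q := by
  induction P using MvPolynomial.induction_on generalizing Q with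
  | C f => rw [subst_C, rep_coeffHom]
  | add p q hp hq => rw [map_add, map_add, LinearMap.add_apply, hp, hq, add_mul]
  | mul_X p k hp =>
    rw [map_mul, map_mul, Module.End.mul_apply, hp, mul_assoc, subst_X, coeff_cPoly]
    congr 1
    refine (algHom_sub_apply (M := PolyU K n) _ _ _ _).trans ?_
    simp only [map_sum, map_mul, LinearMap.sum_apply,
      Module.End.mul_apply, rep_coeffHom, Gam_eq, rep_xGen, rep_dGen, dRep_xRep]
    simp only [← mul_assoc]
    rw [← Finset.sum_mul, sum_eDiv_mul_gamPoly, add_mul]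
    exact add_sub_cancel_right (G := PolyU K n) _ _

/-- The element `P(c)` acts as multiplication by `P`, so its value at `1` recovers `P`. -/
theorem subst_injective (hρ : IsAdmissible s ρ) : Function.Injective (subst hρ) := by
  intro P Q hPQ
  have := rep_subst hρ P 1
  rwa [hPQ, rep_subst, mul_one, mul_one, eq_comm] at this

end Representation

/-! ### The center -/

section Center

variable {K : Type*} [Field K] [CharZero K] {n : ℕ} {s : Fin n → Ubar K n} {ρ : (Ubar K n)[X]}

theorem centerHom_injective (hρ : IsAdmissible s ρ) : Function.Injective (centerHom hρ) := by
  intro p q hpq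
  have := congrArg (Subtype.val) hpq
  rw [← subst_map, ← subst_map] at this
  exact MvPolynomial.map_injective _ algebraMap_Ubar_injective (subst_injective hρ this)

theorem centerHom_surjective (hρ : IsAdmissible s ρ) : Function.Surjective (centerHom hρ) := by
  intro z
  have hz := Subalgebra.mem_center_iff.mp z.2
  obtain ⟨P, hP⟩ := mem_range_of_adH_eq_zero hρ (a := z) fun i => by
    rw [adH_apply, hz, sub_self]
  have hP' : subst hρ P = z := hP
  have hinv : ∀ j, shiftPoly K j P = P := by
    intro j
    have e : subst hρ (shiftPoly K j P) * xGen s j = subst hρ P * xGen s j := by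
      rw [← xGen_mul_subst, hP', hz]
    -- Evaluating at the preimage of `1` under `xʲ` cancels `xʲ` without knowing that it is a
    -- regular element of the algebra.
    obtain ⟨Q, hQ⟩ := xRep_surjective j (1 : PolyU K n)
    have e' := congrArg (fun a => rep hρ a Q) e
    simpa only [map_mul, Module.End.mul_apply, rep_xGen, hQ, rep_subst, mul_one] using e'
  obtain ⟨p, rfl⟩ := exists_map_of_shiftPoly_eq hinv
  exact ⟨p, Subtype.ext (by rw [← subst_map, hP'])⟩

end Center

end HDiff

theorem mainTheorem5 {K : Type*} [Field K] [IsAlgClosed K] [CharZero K] (n : ℕ)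
    (σ : HDiff.Ubar K n) (hσ : σ ∈ HDiff.W K n) :
    (∃ ρ : Polynomial (HDiff.Ubar K n), HDiff.IsRho σ ρ) ∧
    (∀ (q : Fin n → Polynomial K) (p : Polynomial K),
      σ = ∑ k, HDiff.toW K k (q k) → p.degree < n →
        HDiff.IsRho σ (HDiff.explicitRho q p)) ∧
    (∀ ρ : Polynomial (HDiff.Ubar K n), HDiff.IsRho σ ρ →
      ∃ φ : MvPolynomial (Fin n) K ≃ₐ[K] Subalgebra.center K (HDiff.DiffPot σ),
        ∀ k : Fin n, (φ (MvPolynomial.X k) : HDiff.DiffPot σ) =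
          (HDiff.cPoly (fun j => HDiff.delta j σ) ρ).coeff k) := by
  refine ⟨?_, fun q p hq hp => ?_, fun ρ hρ => ?_⟩
  · obtain ⟨q, rfl⟩ := HDiff.exists_of_mem_W hσ
    exact ⟨_, HDiff.isRho_explicitRho q 0 (by simp)⟩
  · subst hq
    exact HDiff.isRho_explicitRho q p hp
  · exact ⟨AlgEquiv.ofBijective (HDiff.centerHom hρ.isAdmissible)
      ⟨HDiff.centerHom_injective _, HDiff.centerHom_surjective _⟩,
      fun k => HDiff.centerHom_X hρ.isAdmissible k⟩
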